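/- **Theorem 2.** *Setting.* Let $\mathcal X=\{x\in\mathbb R^n: Hx=h,\ Ax\ge d\}$ be compact, let $\xi$ be a random vector in $\mathbb R^n$ with a Gaussian mixture law $\sum_{k=1}^K w_k\,\mathcal N(\mu_k,\Sigma_k)$ ($w\ge 0$, $\sum_k w_k=1$), let $c\in\mathbb R^n$, $b\in\mathbb R$, $\theta\in(0,1)$, put $p(x)=\mathbb P[\xi^\top x\le b]$ and, for real $\theta'$, $P(\theta')=\{x\in\mathcal X: p(x)\ge\theta'\}$, $Z^*(\theta')=\min_{x\in P(\theta')}c^\top x$. Problem (1) is $\min\{c^\top x: x\in P(\theta)\}$; let $x^*(\theta)$ be an optimal solution of it. A point $x$ is $\varepsilon$-optimal if $x\in\mathcal X$, $p(x)\ge\theta-\varepsilon$ and $|c^\top x^*(\theta)-c^\top x|\le\varepsilon$. *Piecewise linear approximations.* Let $\Phi,\phi$ be the standard normal CDF and density. A breakpoint array is $\check z_{-L}<\dots<\check z_{-1}<\check z_0=0<\check z_1<\dots<\check z_R$ with $L,R\ge1$; it has $L+R+1$ breakpoints. Let $T_i(z)=\Phi(\check z_i)+\phi(\check z_i)(z-\check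 z_i)$ be the tangent of $\Phi$ at $\check z_i$ and $S_i$ the affine function through $(\check z_{i-1},\Phi(\check z_{i-1}))$ and $(\check z_i,\Phi(\check z_i))$. Define $$\bar\Phi(z)=\begin{cases}\min\{1,\min_{0\le i\le R}T_i(z)\}&z\ge0\\ \max\{\Phi(\check z_{-L}),\max_{-L+1\le i\le 0}S_i(z)\}&z<0\end{cases}\qquad \underline\Phi(z)=\begin{cases}\min\{\Phi(\check z_R),\min_{1\le i\le R}S_i(z)\}&z\ge0\\ \max\{0,\max_{-L\le i\le0}T_i(z)\}&z<0.\end{cases}$$ An array is outer (inner) $\tau$-accurate if $\max\{1-\Phi(\check z_R),\Phi(\check z_{-L})\}\le\tau$ and $0\le\bar\Phi-\Phi\le\tau$ (respectively $0\le\Phi-\underline\Phi\le\tau$) on $\mathbb R$. *Models.* Fix bounds $\underline z\le\check z_{-L}$ and $\bar z\ge\check z_R$. Both models minimize $c^\top x$ over $x\in\mathcal X$, $z\in\mathbb R^K$, $\zeta\in[0,1]^K$, $\lambda\in\mathbb R_+^K$ and auxiliary variables for each $k$, subject to $\sum_k w_k\zeta_k\ge\theta$ and, for every $k$, $b-x^\top\mu_k\ge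 z_k\lambda_k$, $x^\top\Sigma_kx=\lambda_k^2$, and a mixed-binary system. Write $T_i(z)=g_iz+g_i^0$ and $S_i(z)=s_iz+s_i^0$. In the outer model (9) the system in $(\alpha,t,y,z_k,\zeta_k)$, $\alpha\in\mathbb R_+^{\{0,\dots,L\}}$, $t\in\{0,1\}^3$, $y\in\mathbb R^3$, is $$\begin{aligned}&\Phi(\check z_{-L})t_1+t_2+g_iy_3+g_i^0t_3\ge\zeta_k\ (0\le i\le R),\quad \Phi(\check z_{-L})t_1+\textstyle\sum_{i=0}^L\alpha_i\Phi(\check z_{-i})+t_3\ge\zeta_k,\\ &t_1+t_2+t_3=1,\quad z_k=y_1+y_2+y_3,\quad \underline z\,t_1\le y_1\le\check z_{-L}t_1,\quad 0\le y_3\le\bar z\,t_3,\\ &y_2=\textstyle\sum_{i=0}^L\alpha_i\check z_{-i},\quad t_2=\sum_{i=0}^L\alpha_i,\quad \text{at most two } \alpha_i \text{ nonzero, and if two, then adjacent.}\end{aligned}$$ In the inner model (12) the system in $(\alpha,v,t,y,z_k,\zeta_k)$, $\alpha\in\{0,1\}^{\{0,\dots,L-1\}}$, $v\in\mathbb R^{\{0,\dots,L-1\}}$,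 $t\in\{0,1\}^4$, $y\in\mathbb R^4$, is $$\begin{aligned}&t_1+t_2+s_iy_3+s_i^0t_3+\Phi(\check z_R)t_4\ge\zeta_k\ (1\le i\le R),\\ &g_{-L}y_1+g_{-L}^0t_1+\textstyle\sum_{i=0}^{L-1}(g_{-i}v_i+g_{-i}^0\alpha_i)+t_3+\Phi(\check z_R)t_4\ge\zeta_k,\quad g_{-L}y_1+g^0_{-L}t_1\ge0,\\ &t_1+t_2+t_3+t_4=1,\quad z_k=y_1+y_2+y_3+y_4,\quad \underline z\,t_1\le y_1\le\check z_{-L}t_1,\quad t_2=\textstyle\sum_{i=0}^{L-1}\alpha_i,\\ &\check z_{-i-1}\alpha_i\le v_i\le0\ (0\le i\le L-1),\quad y_2=\textstyle\sum_{i=0}^{L-1}v_i,\quad 0\le y_3\le\check z_Rt_3,\quad \check z_Rt_4\le y_4\le\bar z\,t_4.\end{aligned}$$ *Assumptions.* (1) Every $\Sigma_k$ is positive definite. (2) There is $\rho>0$ with $P(\theta')\ne\emptyset$ for all $\theta'\in[\theta-\rho,\theta+\rho]$. (3) If $b=0$, there is $\delta>0$ such that $P(\theta)$ contains no $x$ with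 $\|x\|\le\delta$. (4) LICQ holds at every optimal solution $x$ of (1): the rows of $H$, the rows of $A$ whose inequality is binding at $x$, and, if $p(x)=\theta$, the gradient $\nabla p(x)$, are linearly independent. *Conclusion.* There is an absolute constant $C$ such that, under these assumptions, for every $\hat\tau>0$ there is $\tau$ with $0<\tau\le\hat\tau$ for which the following hold. There exist an outer $\tau$-accurate and an inner $\tau$-accurate breakpoint array, each with at most $C\sqrt{\frac1\tau\log\frac1\tau}$ breakpoints. The minima $Z^*(\theta\pm\tau)$ are attained. For every outer $\tau$-accurate array in (9), every inner $\tau$-accurate array in (12), and all bounds $\underline z\le\check z_{-L}$, $\bar z\ge\check z_R$ (chosen separately in the two models), both models have optimal solutions, and the $x$-parts $x^{OA}$, $x^{IA}$ of all their optimal solutions are $\hat\tau$-optimal and satisfy $$|c^\top x^{IA}-c^\top x^{OA}|\le|Z^*(\theta+\tau)-Z^*(\theta-\tau)|\le\hat\tau.$$ -/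

import Mathlib

open MeasureTheory ProbabilityTheory
open scoped Matrix

noncomputable section

namespace GMMChance

/-! ### The chance-constrained problem -/

/-- Data of the linear chance-constrained problem
`min cᵀx` subject to `H x = h`, `A x ≥ d`, `ℙ[ξᵀ x ≤ b] ≥ θ`,
where `ξ` follows the Gaussian mixture with weights `w`, means `mu` and covariances `Sig`.
The probability level `θ` is kept as a separate argument. -/
structure Problem (n K mE mI : ℕ) where
  c : EuclideanSpace ℝ (Fin n)
  H : Matrix (Fin mE) (Fin n) ℝ
  h : Fin mE → ℝ
  A : Matrix (Fin mI) (Fin n) ℝ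
  d : Fin mI → ℝ
  b : ℝ
  w : Fin K → ℝ
  mu : Fin K → EuclideanSpace ℝ (Fin n)
  Sig : Fin K → Matrix (Fin n) (Fin n) ℝ

namespace Problem

variable {n K mE mI : ℕ} (S : Problem n K mE mI)

/-- The mixture weights form a probability vector. -/
def WeightsValid : Prop := (∀ k, 0 ≤ S.w k) ∧ ∑ k, S.w k = 1

/-- The deterministic feasible region `{x | H x = h, A x ≥ d}`. -/
def X : Set (EuclideanSpace ℝ (Fin n)) :=
  {x | (∀ i, (S.H *ᵥ x.ofLp) i = S.h i) ∧ ∀ i, S.d i ≤ (S.A *ᵥ x.ofLp) i}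

/-- The law of the random vector `ξ`: the Gaussian mixture `∑ₖ wₖ N(μₖ, Σₖ)`. -/
def law : Measure (EuclideanSpace ℝ (Fin n)) :=
  ∑ k, ENNReal.ofReal (S.w k) • multivariateGaussian (S.mu k) (S.Sig k)

/-- The probability function `p(x) = ℙ[ξᵀ x ≤ b]`. -/
def p (x : EuclideanSpace ℝ (Fin n)) : ℝ :=
  S.law.real {ξ | inner ℝ ξ x ≤ S.b}

/-- The feasible region `P(θ)`. -/
def P (θ : ℝ) : Set (EuclideanSpace ℝ (Fin n)) :=
  {x | x ∈ S.X ∧ θ ≤ S.p x}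

/-- The objective `cᵀ x`. -/
def obj (x : EuclideanSpace ℝ (Fin n)) : ℝ := inner ℝ S.c x

/-- `x` is an optimal solution of the chance-constrained problem at level `θ`. -/
def IsOptimal (θ : ℝ) (x : EuclideanSpace ℝ (Fin n)) : Prop :=
  x ∈ S.P θ ∧ ∀ y ∈ S.P θ, S.obj x ≤ S.obj y

/-- Linear independence constraint qualification at `x`: the gradients of the equality
constraints, of the binding linear inequalities, and of the chance constraint
(if it is binding) are linearly independent as a family. -/
def LICQ (θ : ℝ) (x : EuclideanSpace ℝ (Fin n)) : Prop :=
  LinearIndependent ℝ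
    (Sum.elim (fun i : Fin mE => WithLp.toLp 2 (S.H i))
      (Sum.elim
        (fun i : {i : Fin mI // (S.A *ᵥ x.ofLp) i = S.d i} => WithLp.toLp 2 (S.A i.1))
        (fun _ : {_u : Unit // S.p x = θ} => gradient S.p x)) :
      Fin mE ⊕ {i : Fin mI // (S.A *ᵥ x.ofLp) i = S.d i} ⊕ {_u : Unit // S.p x = θ} →
        EuclideanSpace ℝ (Fin n))

/-- `x` is `ε`-feasible for the problem at level `θ`. -/
def IsTolFeasible (θ ε : ℝ) (x : EuclideanSpace ℝ (Fin n)) : Prop :=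
  x ∈ S.X ∧ θ - ε ≤ S.p x

/-- `x` is `ε`-optimal for the problem at level `θ`, `xs` being an optimal solution. -/
def IsTolOptimal (θ ε : ℝ) (xs x : EuclideanSpace ℝ (Fin n)) : Prop :=
  S.IsTolFeasible θ ε x ∧ |S.obj xs - S.obj x| ≤ ε

end Problem

/-! ### Piecewise linear approximations of the standard normal CDF -/

/-- The standard normal cumulative distribution function. -/
def Phi (z : ℝ) : ℝ := cdf (gaussianReal 0 1) z

/-- The standard normal density. -/
def phi (z : ℝ) : ℝ := gaussianPDFReal 0 1 z

/-- A valid array of breakpoints `ž₋L < ⋯ < ž₋₁ < ž₀ = 0 < ž₁ < ⋯ < ž_R` with `L, R > 0`.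
Only the values of `pt` on the integers from `-L` to `R` matter. -/
structure Breakpoints where
  L : ℕ
  R : ℕ
  L_pos : 0 < L
  R_pos : 0 < R
  pt : ℤ → ℝ
  pt_zero : pt 0 = 0
  pt_strictMono : StrictMonoOn pt (Set.Icc (-(L : ℤ)) (R : ℤ))

namespace Breakpoints

variable (B : Breakpoints)

/-- The number of breakpoints in the array. -/
def count : ℕ := B.L + B.R + 1

/-- The leftmost breakpoint. -/
def leftEnd : ℝ := B.pt (-(B.L : ℤ))

/-- The rightmost breakpoint. -/
def rightEnd : ℝ := B.pt (B.R : ℤ)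

/-- Slope of the tangent of `Phi` at the breakpoint with index `i`. -/
def tanSlope (i : ℤ) : ℝ := phi (B.pt i)

/-- Intercept of the tangent of `Phi` at the breakpoint with index `i`. -/
def tanIcpt (i : ℤ) : ℝ := Phi (B.pt i) - phi (B.pt i) * B.pt i

/-- Slope of the secant of `Phi` through the breakpoints with indices `i - 1` and `i`. -/
def secSlope (i : ℤ) : ℝ :=
  (Phi (B.pt i) - Phi (B.pt (i - 1))) / (B.pt i - B.pt (i - 1))

/-- Intercept of the secant of `Phi` through the breakpoints with indices `i - 1` and `i`. -/
def secIcpt (i : ℤ) : ℝ := Phi (B.pt (i - 1)) - B.secSlope i * B.pt (i - 1)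

/-- The PWL outer approximation of `Phi`: tangents at `ž₀, …, ž_R` on the nonnegative side,
the `L` secants on the negative side. -/
def outer (z : ℝ) : ℝ :=
  if 0 ≤ z then
    min 1 (⨅ i : Fin (B.R + 1), (B.tanSlope (i : ℕ) * z + B.tanIcpt (i : ℕ)))
  else
    max (Phi B.leftEnd) (⨆ i : Fin B.L, (B.secSlope (-(i : ℕ)) * z + B.secIcpt (-(i : ℕ))))

/-- The PWL inner approximation of `Phi`: the `R` secants on the nonnegative side,
tangents at `ž₀, ž₋₁, …, ž₋L` on the negative side. -/
def inner (z : ℝ) : ℝ :=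
  if 0 ≤ z then
    min (Phi B.rightEnd)
      (⨅ i : Fin B.R, (B.secSlope ((i : ℕ) + 1) * z + B.secIcpt ((i : ℕ) + 1)))
  else
    max 0 (⨆ i : Fin (B.L + 1), (B.tanSlope (-(i : ℕ)) * z + B.tanIcpt (-(i : ℕ))))

/-- The end points of the array cut off tails of mass at most `τ`. -/
def TailsWithin (τ : ℝ) : Prop :=
  max (1 - Phi B.rightEnd) (Phi B.leftEnd) ≤ τ

/-- The array gives a `τ`-accurate outer approximation of `Phi`. -/
def OuterAccurate (τ : ℝ) : Prop :=
  B.TailsWithin τ ∧ ∀ z, 0 ≤ B.outer z - Phi z ∧ B.outer z - Phi z ≤ τ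

/-- The array gives a `τ`-accurate inner approximation of `Phi`. -/
def InnerAccurate (τ : ℝ) : Prop :=
  B.TailsWithin τ ∧ ∀ z, 0 ≤ Phi z - B.inner z ∧ Phi z - B.inner z ≤ τ

end Breakpoints

/-- `s` is a binary variable. -/
def IsBinary (s : ℝ) : Prop := s = 0 ∨ s = 1

/-- Type-2 special ordered set: at most two entries are nonzero, and two nonzero entries
are adjacent. -/
def IsSOS2 {m : ℕ} (α : Fin m → ℝ) : Prop :=
  ∃ j : ℕ, ∀ i : Fin m, α i ≠ 0 → (i : ℕ) = j ∨ (i : ℕ) = j + 1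

/-- The mixed-binary set modelling `B.outer z ≥ ζ` with `z ∈ [lo, up]`. The entries
`t 0, t 1, t 2` and `y 0, y 1, y 2` are `t₁, t₂, t₃` and `y₁, y₂, y₃`. -/
def MemOuterSet (B : Breakpoints) (lo up : ℝ)
    (α : Fin (B.L + 1) → ℝ) (t y : Fin 3 → ℝ) (z ζ : ℝ) : Prop :=
  (∀ i, 0 ≤ α i) ∧ (∀ j, IsBinary (t j)) ∧
  (∀ i : Fin (B.R + 1),
    ζ ≤ Phi B.leftEnd * t 0 + t 1 + B.tanSlope (i : ℕ) * y 2 + B.tanIcpt (i : ℕ) * t 2) ∧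
  ζ ≤ Phi B.leftEnd * t 0 + (∑ i : Fin (B.L + 1), α i * Phi (B.pt (-(i : ℕ)))) + t 2 ∧
  t 0 + t 1 + t 2 = 1 ∧
  z = y 0 + y 1 + y 2 ∧
  t 0 * lo ≤ y 0 ∧ y 0 ≤ t 0 * B.leftEnd ∧
  0 ≤ y 2 ∧ y 2 ≤ t 2 * up ∧
  y 1 = ∑ i : Fin (B.L + 1), α i * B.pt (-(i : ℕ)) ∧
  t 1 = ∑ i : Fin (B.L + 1), α i ∧
  IsSOS2 α

/-- The mixed-binary set modelling `B.inner z ≥ ζ` with `z ∈ [lo, up]`. The entries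
`t 0, …, t 3` and `y 0, …, y 3` are `t₁, …, t₄` and `y₁, …, y₄`; the variable `v i` is the
value of `z` on the piece selected by `α i`. -/
def MemInnerSet (B : Breakpoints) (lo up : ℝ)
    (α v : Fin B.L → ℝ) (t y : Fin 4 → ℝ) (z ζ : ℝ) : Prop :=
  (∀ i, IsBinary (α i)) ∧ (∀ j, IsBinary (t j)) ∧
  (∀ i : Fin B.R,
    ζ ≤ t 0 + t 1 + B.secSlope ((i : ℕ) + 1) * y 2 + B.secIcpt ((i : ℕ) + 1) * t 2 +
      Phi B.rightEnd * t 3) ∧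
  ζ ≤ B.tanSlope (-(B.L : ℤ)) * y 0 + B.tanIcpt (-(B.L : ℤ)) * t 0 +
      (∑ i : Fin B.L, (B.tanSlope (-(i : ℕ)) * v i + B.tanIcpt (-(i : ℕ)) * α i)) +
      t 2 + Phi B.rightEnd * t 3 ∧
  0 ≤ B.tanSlope (-(B.L : ℤ)) * y 0 + B.tanIcpt (-(B.L : ℤ)) * t 0 ∧
  t 0 + t 1 + t 2 + t 3 = 1 ∧
  z = y 0 + y 1 + y 2 + y 3 ∧
  lo * t 0 ≤ y 0 ∧ y 0 ≤ B.leftEnd * t 0 ∧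
  t 1 = ∑ i, α i ∧
  (∀ i : Fin B.L, B.pt (-(i : ℕ) - 1) * α i ≤ v i ∧ v i ≤ 0) ∧
  y 1 = ∑ i, v i ∧
  0 ≤ y 2 ∧ y 2 ≤ B.rightEnd * t 2 ∧
  B.rightEnd * t 3 ≤ y 3 ∧ y 3 ≤ up * t 3

namespace Problem

variable {n K mE mI : ℕ} (S : Problem n K mE mI)

/-- The constraints common to the two mixed-integer models. -/
def CommonConstraints (θ : ℝ) (x : EuclideanSpace ℝ (Fin n)) (z ζ lam : Fin K → ℝ) : Prop :=
  θ ≤ ∑ k, S.w k * ζ k ∧ x ∈ S.X ∧ (∀ k, 0 ≤ ζ k ∧ ζ k ≤ 1) ∧ (∀ k, 0 ≤ lam k) ∧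
  ∀ k, z k * lam k ≤ S.b - Inner.inner ℝ x (S.mu k) ∧
    x.ofLp ⬝ᵥ (S.Sig k *ᵥ x.ofLp) = lam k ^ 2

/-- Feasibility in the PWL outer model. -/
def OuterFeasible (θ : ℝ) (B : Breakpoints) (lo up : ℝ)
    (x : EuclideanSpace ℝ (Fin n)) (z ζ lam : Fin K → ℝ)
    (α : Fin K → Fin (B.L + 1) → ℝ) (t y : Fin K → Fin 3 → ℝ) : Prop :=
  S.CommonConstraints θ x z ζ lam ∧
  ∀ k, MemOuterSet B lo up (α k) (t k) (y k) (z k) (ζ k)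

/-- `x` is the decision part of an optimal solution of the PWL outer model. -/
def IsOuterOptimal (θ : ℝ) (B : Breakpoints) (lo up : ℝ)
    (x : EuclideanSpace ℝ (Fin n)) : Prop :=
  (∃ z ζ lam α t y, S.OuterFeasible θ B lo up x z ζ lam α t y) ∧
  ∀ x' z' ζ' lam' α' t' y', S.OuterFeasible θ B lo up x' z' ζ' lam' α' t' y' →
    S.obj x ≤ S.obj x'

/-- Feasibility in the PWL inner model. -/
def InnerFeasible (θ : ℝ) (B : Breakpoints) (lo up : ℝ)
    (x : EuclideanSpace ℝ (Fin n)) (z ζ lam : Fin K → ℝ)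
    (α v : Fin K → Fin B.L → ℝ) (t y : Fin K → Fin 4 → ℝ) : Prop :=
  S.CommonConstraints θ x z ζ lam ∧
  ∀ k, MemInnerSet B lo up (α k) (v k) (t k) (y k) (z k) (ζ k)

/-- `x` is the decision part of an optimal solution of the PWL inner model. -/
def IsInnerOptimal (θ : ℝ) (B : Breakpoints) (lo up : ℝ)
    (x : EuclideanSpace ℝ (Fin n)) : Prop :=
  (∃ z ζ lam α v t y, S.InnerFeasible θ B lo up x z ζ lam α v t y) ∧
  ∀ x' z' ζ' lam' α' v' t' y', S.InnerFeasible θ B lo up x' z' ζ' lam' α' v' t' y' →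
    S.obj x ≤ S.obj x'

end Problem

end GMMChance

end

namespace GMMChance

open Set Filter Topology

/-! For x ≠ 0, p(x) = ∑ wₖ `Phi` (mₖ(x)) with the margins mₖ(x) = (b - xᵀμₖ)/√(xᵀΣₖx). The models
replace each value of `Phi` by an approximation with error at most τ. The weights sum to 1, so the
total error is at most τ, and the x feasible for either model form a set between P(θ+τ) and P(θ-τ)
(`P_subset_modelFeasible`, `modelFeasible_subset_P`). Both optimal values then lie in [Z*(θ-τ),
Z*(θ+τ)], and the claim reduces to continuity of Z* at θ.

Below θ, Z* cannot drop suddenly because p is upper semicontinuous and X is compact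
(`exists_obj_le_of_level_sub`). Above θ it cannot rise suddenly: if p(x*) = θ, LICQ provides a
direction that preserves the binding linear constraints and raises p at rate 1
(`exists_obj_le_of_level_add`).

The delicate inclusion is that of P(θ+τ) in the models, since their systems only reach bounded z,
and the inner one ties each tangent to a range of z. Large margins are capped at `up`. The margins
have a common lower bound M on P(θ) (`exists_le_margin`); the condition at b = 0 enters here. For τ
small in terms of M, every array with tails of mass at most τ extends to the left of M, and its
leftmost tangent is never needed on [M, 0) (`exists_tails_threshold`, `exists_tangent_index`).

The breakpoint count comes from a uniform mesh of spacing √τ, sufficient because |`Phi`''| ≤ 1, on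
|z| ≤ √(2 log(1/τ)), sufficient by a Chernoff bound (`exists_accurate`). -/

/-! ### The standard normal density and distribution function -/

lemma phi_eq (z : ℝ) : phi z = (√(2 * Real.pi))⁻¹ * Real.exp (-z ^ 2 / 2) := by
  simp [phi, gaussianPDFReal]

lemma phi_pos (z : ℝ) : 0 < phi z := gaussianPDFReal_pos 0 1 z one_ne_zero

lemma phi_neg (z : ℝ) : phi (-z) = phi z := by simp [phi_eq]

lemma continuous_phi : Continuous phi := by
  have : phi = fun z => (√(2 * Real.pi))⁻¹ * Real.exp (-z ^ 2 / 2) := funext phi_eq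
  rw [this]; fun_prop

lemma integrable_phi : Integrable phi := integrable_gaussianPDFReal 0 1

lemma phi_le_of_sq_le {a b : ℝ} (h : a ^ 2 ≤ b ^ 2) : phi b ≤ phi a := by
  rw [phi_eq, phi_eq]; gcongr

lemma phi_monotoneOn : MonotoneOn phi (Iic 0) := fun a ha b hb hab => by
  simp only [mem_Iic] at ha hb
  exact phi_le_of_sq_le (by nlinarith)

lemma Phi_eq_integral (z : ℝ) : Phi z = ∫ t in Iic z, phi t := by
  rw [Phi, cdf_eq_real, measureReal_def, gaussianReal_apply_eq_integral 0 one_ne_zero,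
    ENNReal.toReal_ofReal]
  · rfl
  · exact setIntegral_nonneg measurableSet_Iic fun t _ => (phi_pos t).le

lemma Phi_sub_Phi (a b : ℝ) : Phi b - Phi a = ∫ t in a..b, phi t := by
  rw [Phi_eq_integral, Phi_eq_integral,
    intervalIntegral.integral_Iic_sub_Iic integrable_phi.integrableOn integrable_phi.integrableOn]

lemma hasDerivAt_Phi (z : ℝ) : HasDerivAt Phi (phi z) z := by
  have h : Phi = fun z => Phi 0 + ∫ t in (0 : ℝ)..z, phi t := by
    funext z; rw [← Phi_sub_Phi]; ring
  rw [h]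
  exact (intervalIntegral.integral_hasDerivAt_right (continuous_phi.intervalIntegrable _ _)
    continuous_phi.stronglyMeasurable.stronglyMeasurableAtFilter
    continuous_phi.continuousAt).const_add _

lemma continuous_Phi : Continuous Phi :=
  continuous_iff_continuousAt.2 fun z => (hasDerivAt_Phi z).continuousAt

lemma deriv_Phi : deriv Phi = phi := funext fun z => (hasDerivAt_Phi z).deriv

lemma Phi_strictMono : StrictMono Phi :=
  strictMono_of_deriv_pos fun z => by rw [deriv_Phi]; exact phi_pos z

lemma Phi_nonneg (z : ℝ) : 0 ≤ Phi z := cdf_nonneg _ z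

lemma Phi_pos (z : ℝ) : 0 < Phi z := (Phi_nonneg (z - 1)).trans_lt (Phi_strictMono (by linarith))

lemma Phi_le_one (z : ℝ) : Phi z ≤ 1 := cdf_le_one _ z

lemma Phi_tendsto_atBot : Tendsto Phi atBot (𝓝 0) := tendsto_cdf_atBot _

/-- The standard normal law is invariant under negation and has no atoms. Convexity is used only on
the negative half-line; this reflection transfers the estimates to the positive one. -/
lemma Phi_neg (z : ℝ) : Phi (-z) = 1 - Phi z := by
  have hmap : (gaussianReal 0 1).map (fun x : ℝ => -x) = gaussianReal 0 1 := by
    simpa using gaussianReal_map_neg (μ := 0) (v := 1)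
  have : NullSingletonClass (gaussianReal 0 1) := nullSingletonClass_gaussianReal one_ne_zero
  have h1 : (gaussianReal 0 1).real (Iic (-z)) = (gaussianReal 0 1).real (Ici z) := by
    conv_lhs => rw [← hmap]
    rw [map_measureReal_apply (by fun_prop) measurableSet_Iic]
    congr 1; ext x; simp
  have h2 : (gaussianReal 0 1).real (Ici z) = (gaussianReal 0 1).real (Ioi z) :=
    measureReal_congr Ioi_ae_eq_Ici.symm
  have h3 : (Ioi z) = (Iic z)ᶜ := by simp
  rw [Phi, Phi, cdf_eq_real, cdf_eq_real, h1, h2, h3, probReal_compl_eq_one_sub measurableSet_Iic]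

/-- Chernoff bound: exp(tM + t²/2) is smallest at t = -M. -/
lemma Phi_neg_le_exp {M : ℝ} (hM : 0 ≤ M) : Phi (-M) ≤ Real.exp (-M ^ 2 / 2) := by
  have h := measure_le_le_exp_mul_mgf (μ := gaussianReal 0 1) (X := id) (-M) (t := -M)
    (by linarith) (integrable_exp_mul_gaussianReal _)
  rw [mgf_id_gaussianReal, ← Real.exp_add] at h
  rw [Phi, cdf_eq_real]
  refine (le_of_eq rfl).trans (h.trans (le_of_eq ?_))
  congr 1
  push_cast; ring

lemma Phi_mean_value (a z : ℝ) : ∃ c ∈ uIcc a z, Phi z - Phi a = phi c * (z - a) := by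
  rcases lt_trichotomy a z with h | h | h
  · obtain ⟨c, hc, he⟩ := exists_hasDerivAt_eq_slope Phi phi h continuous_Phi.continuousOn
      fun x _ => hasDerivAt_Phi x
    refine ⟨c, ?_, ?_⟩
    · rw [uIcc_of_le h.le]; exact Ioo_subset_Icc_self hc
    · rw [he]; field_simp [sub_ne_zero.2 h.ne']
  · exact ⟨a, left_mem_uIcc, by simp [h]⟩
  · obtain ⟨c, hc, he⟩ := exists_hasDerivAt_eq_slope Phi phi h continuous_Phi.continuousOn
      fun x _ => hasDerivAt_Phi x
    refine ⟨c, ?_, ?_⟩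
    · rw [uIcc_of_ge h.le]; exact Ioo_subset_Icc_self hc
    · have : a - z ≠ 0 := sub_ne_zero.2 h.ne'
      rw [he]; field_simp; ring

/-! ### Tangents and secants of the distribution function -/

lemma hasDerivAt_phi (z : ℝ) : HasDerivAt phi (-z * phi z) z := by
  have h : HasDerivAt (fun z : ℝ => (√(2 * Real.pi))⁻¹ * Real.exp (-z ^ 2 / 2))
      ((√(2 * Real.pi))⁻¹ * (Real.exp (-z ^ 2 / 2) * (-(2 * z) / 2))) z := by
    refine (HasDerivAt.exp ?_).const_mul _
    simpa using ((hasDerivAt_pow 2 z).neg.div_const 2)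
  rw [show phi = fun z => (√(2 * Real.pi))⁻¹ * Real.exp (-z ^ 2 / 2) from funext phi_eq]
  convert h using 1
  ring

/-- This is |`Phi`''| ≤ 1, the source of all second-order errors. It follows from |z| ≤ 1 + z²/2 ≤
exp(z²/2). -/
lemma abs_mul_phi_le_one (z : ℝ) : |z| * phi z ≤ 1 := by
  have h1 : (√(2 * Real.pi))⁻¹ ≤ 1 := by
    apply inv_le_one_of_one_le₀
    rw [Real.one_le_sqrt]
    nlinarith [Real.pi_gt_three]
  have h2 : |z| ≤ Real.exp (z ^ 2 / 2) := by
    have := Real.add_one_le_exp (z ^ 2 / 2)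
    nlinarith [sq_abs z, sq_nonneg (|z| - 1)]
  have h3 : |z| * Real.exp (-z ^ 2 / 2) ≤ 1 := by
    rw [neg_div, Real.exp_neg, ← div_eq_mul_inv]
    exact (div_le_one (Real.exp_pos _)).2 h2
  rw [phi_eq]
  have h0 : 0 ≤ (√(2 * Real.pi))⁻¹ := by positivity
  have h4 : 0 ≤ |z| * Real.exp (-z ^ 2 / 2) := by positivity
  calc |z| * ((√(2 * Real.pi))⁻¹ * Real.exp (-z ^ 2 / 2))
      = (√(2 * Real.pi))⁻¹ * (|z| * Real.exp (-z ^ 2 / 2)) := by ring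
    _ ≤ 1 * 1 := mul_le_mul h1 h3 h4 zero_le_one
    _ = 1 := one_mul 1

lemma abs_phi_sub_le (a b : ℝ) : |phi b - phi a| ≤ |b - a| := by
  have h := Convex.norm_image_sub_le_of_norm_hasDerivWithin_le (f := phi)
    (f' := fun z => -z * phi z) (C := 1) (s := univ) (x := a) (y := b)
    (fun z _ => (hasDerivAt_phi z).hasDerivWithinAt) (fun z _ => by
      rw [Real.norm_eq_abs, abs_mul, abs_neg, abs_of_pos (phi_pos z)]
      exact abs_mul_phi_le_one z) convex_univ (mem_univ _) (mem_univ _)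
  simpa using h

/-- The tangent of `Phi` at `a` approximates `Phi` to second order. -/
lemma abs_Phi_sub_tangent_le (a z : ℝ) :
    |Phi z - (Phi a + phi a * (z - a))| ≤ (z - a) ^ 2 := by
  obtain ⟨c, hc, he⟩ := Phi_mean_value a z
  have h1 : Phi z - (Phi a + phi a * (z - a)) = (phi c - phi a) * (z - a) := by linarith
  have h2 : |c - a| ≤ |z - a| := abs_sub_left_of_mem_uIcc hc
  rw [h1, abs_mul, ← sq_abs, sq]
  exact mul_le_mul_of_nonneg_right ((abs_phi_sub_le a c).trans h2) (abs_nonneg _)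

/-- `phi` increases on the negative half-line, so `Phi` is convex there and lies above its tangents.
-/
lemma tangent_le_Phi {a z : ℝ} (ha : a ≤ 0) (hz : z ≤ 0) :
    Phi a + phi a * (z - a) ≤ Phi z := by
  obtain ⟨c, hc, he⟩ := Phi_mean_value a z
  rcases le_total a z with h | h
  · rw [uIcc_of_le h] at hc
    have := phi_monotoneOn (mem_Iic.2 ha) (mem_Iic.2 (hc.2.trans hz)) hc.1
    nlinarith
  · rw [uIcc_of_ge h] at hc
    have := phi_monotoneOn (mem_Iic.2 (hc.2.trans ha)) (mem_Iic.2 ha) hc.2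
    nlinarith

lemma Phi_le_tangent {a z : ℝ} (ha : 0 ≤ a) (hz : 0 ≤ z) :
    Phi z ≤ Phi a + phi a * (z - a) := by
  have h := tangent_le_Phi (a := -a) (z := -z) (by linarith) (by linarith)
  rw [Phi_neg, Phi_neg, phi_neg] at h
  linarith

/-- The secant of `Phi` through `a` and `b`. -/
noncomputable def secant (a b z : ℝ) : ℝ := Phi a + (Phi b - Phi a) / (b - a) * (z - a)

lemma secant_right {a b : ℝ} (h : a < b) : secant a b b = Phi b := by
  rw [secant, div_mul_cancel₀ _ (sub_ne_zero.2 h.ne')]; ring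

lemma secant_neg {a b : ℝ} (h : a < b) (z : ℝ) : secant (-b) (-a) (-z) = 1 - secant a b z := by
  have : b - a ≠ 0 := sub_ne_zero.2 h.ne'
  have h' : -a - -b = b - a := by ring
  rw [secant, secant, Phi_neg, Phi_neg, h']
  field_simp
  ring

lemma exists_phi_eq_slope {a b : ℝ} (h : a < b) :
    ∃ c ∈ Icc a b, (Phi b - Phi a) / (b - a) = phi c := by
  obtain ⟨c, hc, he⟩ := Phi_mean_value a b
  rw [uIcc_of_le h.le] at hc
  exact ⟨c, hc, by rw [he, mul_div_cancel_right₀ _ (sub_ne_zero.2 h.ne')]⟩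

/-- The slope of the secant and the mean slope of `Phi` on [a, z] are both values of the 1-Lipschitz
function `phi` on [a, b]. -/
lemma abs_Phi_sub_secant_le {a b z : ℝ} (h : a < b) (hz : z ∈ Icc a b) :
    |Phi z - secant a b z| ≤ (b - a) ^ 2 := by
  obtain ⟨c, hc, he⟩ := Phi_mean_value a z
  obtain ⟨c', hc', he'⟩ := exists_phi_eq_slope h
  rw [uIcc_of_le hz.1] at hc
  have h1 : Phi z - secant a b z = (phi c - phi c') * (z - a) := by
    rw [secant, he']; linarith
  have h2 : |c - c'| ≤ b - a := by
    rw [abs_le]; constructor <;> linarith [hc.1, hc.2, hc'.1, hc'.2, hz.2]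
  have h3 : |z - a| ≤ b - a := by
    rw [abs_le]; constructor <;> linarith [hz.1, hz.2]
  rw [h1, abs_mul, sq]
  exact mul_le_mul ((abs_phi_sub_le c' c).trans h2) h3 (abs_nonneg _) (by linarith)

lemma Phi_le_secant {a b z : ℝ} (h : a < b) (hb : b ≤ 0) (hz : z ∈ Icc a b) :
    Phi z ≤ secant a b z := by
  obtain ⟨c, hc, he⟩ := Phi_mean_value a z
  obtain ⟨c', hc', he'⟩ := Phi_mean_value z b
  rw [uIcc_of_le hz.1] at hc
  rw [uIcc_of_le hz.2] at hc'
  have hcc : phi c ≤ phi c' := phi_monotoneOn (mem_Iic.2 (by linarith [hc.2, hz.2]))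
    (mem_Iic.2 (by linarith [hc'.2])) (hc.2.trans hc'.1)
  have hba : 0 < b - a := by linarith
  -- The slope over [a, b] is the weighted mean of the mean slopes over [a, z] and [z, b], the
  -- second of which is the larger by convexity.
  have h1 : secant a b z = Phi a + (phi c' * (b - z) + phi c * (z - a)) / (b - a) * (z - a) := by
    rw [secant]; congr 3; linarith
  have h2 : phi c ≤ (phi c' * (b - z) + phi c * (z - a)) / (b - a) := by
    rw [le_div_iff₀ hba]; nlinarith [hz.2]
  rw [h1]
  nlinarith [hz.1]

/-- A chord of a convex function lies below it outside its own interval. Hence a maximum of secants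
can exceed `Phi` only through the piece containing z. -/
lemma secant_le_Phi_of_notMem {a b z : ℝ} (h : a < b) (hb : b ≤ 0) (hz : z ≤ 0)
    (hz' : z ≤ a ∨ b ≤ z) : secant a b z ≤ Phi z := by
  obtain ⟨c', hc', he'⟩ := exists_phi_eq_slope h
  have key : secant a b z = Phi a + phi c' * (z - a) := by rw [secant, he']
  have key' : secant a b z = Phi b + phi c' * (z - b) := by
    have : Phi b - Phi a = phi c' * (b - a) := by
      rw [← he', div_mul_cancel₀ _ (sub_ne_zero.2 h.ne')]
    rw [key]; linarith
  rcases hz' with hz' | hz'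
  · obtain ⟨c, hc, he⟩ := Phi_mean_value a z
    rw [uIcc_of_ge hz'] at hc
    have : phi c ≤ phi c' := phi_monotoneOn (mem_Iic.2 (by linarith [hc.2]))
      (mem_Iic.2 (by linarith [hc'.2])) (hc.2.trans hc'.1)
    rw [key]; nlinarith
  · obtain ⟨c, hc, he⟩ := Phi_mean_value b z
    rw [uIcc_of_le hz'] at hc
    have : phi c' ≤ phi c := phi_monotoneOn (mem_Iic.2 (by linarith [hc'.2]))
      (mem_Iic.2 (by linarith [hc.2])) (hc'.2.trans hc.1)
    rw [key']; nlinarith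

lemma secant_le_Phi {a b z : ℝ} (h : a < b) (ha : 0 ≤ a) (hz : z ∈ Icc a b) :
    secant a b z ≤ Phi z := by
  have := Phi_le_secant (a := -b) (b := -a) (z := -z) (by linarith) (by linarith)
    ⟨by linarith [hz.2], by linarith [hz.1]⟩
  rw [secant_neg h, Phi_neg] at this
  linarith

lemma Phi_le_secant_of_notMem {a b z : ℝ} (h : a < b) (ha : 0 ≤ a) (hz : 0 ≤ z)
    (hz' : z ≤ a ∨ b ≤ z) : Phi z ≤ secant a b z := by
  have := secant_le_Phi_of_notMem (a := -b) (b := -a) (z := -z) (by linarith) (by linarith)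
    (by linarith) (hz'.symm.imp (fun h => by linarith) fun h => by linarith)
  rw [secant_neg h, Phi_neg] at this
  linarith

/-- The tangent at a, evaluated at a/2, is at most `Phi` (a/2). Doubling this inequality bounds the
value at 0 by 2 `Phi` (a/2). -/
lemma Phi_tangent_zero_tendsto_atBot :
    Tendsto (fun a => Phi a + phi a * -a) atBot (𝓝 0) := by
  have h1 : Tendsto (fun a : ℝ => Phi (a / 2) * 2) atBot (𝓝 0) := by
    simpa using (Phi_tendsto_atBot.comp
      (tendsto_id.atBot_div_const (by norm_num : (0 : ℝ) < 2))).mul_const 2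
  refine tendsto_of_tendsto_of_tendsto_of_le_of_le' tendsto_const_nhds h1 ?_ ?_
  · filter_upwards [eventually_le_atBot 0] with a ha
    nlinarith [Phi_nonneg a, phi_pos a]
  · filter_upwards [eventually_le_atBot 0] with a ha
    have := tangent_le_Phi (a := a) (z := a / 2) ha (by linarith)
    nlinarith [Phi_nonneg a]

lemma exists_mem_Icc_succ {f : ℕ → ℝ} {z : ℝ} {N : ℕ} (hN : 0 < N) (h0 : f 0 ≤ z)
    (hz : z ≤ f N) : ∃ i < N, f i ≤ z ∧ z ≤ f (i + 1) := by
  induction N, hN using Nat.le_induction with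
  | base => exact ⟨0, one_pos, h0, hz⟩
  | succ N hN ih =>
    rcases le_total z (f N) with h | h
    · obtain ⟨i, hi, hi'⟩ := ih h
      exact ⟨i, hi.trans N.lt_succ_self, hi'⟩
    · exact ⟨N, N.lt_succ_self, h, hz⟩

/-! ### Accuracy of breakpoint arrays -/

namespace Breakpoints

variable (B : Breakpoints)

lemma tan_eq (i : ℤ) (z : ℝ) :
    B.tanSlope i * z + B.tanIcpt i = Phi (B.pt i) + phi (B.pt i) * (z - B.pt i) := by
  rw [tanSlope, tanIcpt]; ring

lemma sec_eq (i : ℤ) (z : ℝ) :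
    B.secSlope i * z + B.secIcpt i = secant (B.pt (i - 1)) (B.pt i) z := by
  rw [secIcpt, secant, secSlope]; ring

lemma pt_lt {i j : ℤ} (hi : -(B.L : ℤ) ≤ i) (hij : i < j) (hj : j ≤ B.R) : B.pt i < B.pt j :=
  B.pt_strictMono ⟨hi, by omega⟩ ⟨by omega, hj⟩ hij

lemma pt_le {i j : ℤ} (hi : -(B.L : ℤ) ≤ i) (hij : i ≤ j) (hj : j ≤ B.R) : B.pt i ≤ B.pt j :=
  B.pt_strictMono.monotoneOn ⟨hi, by omega⟩ ⟨by omega, hj⟩ hij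

lemma pt_nonneg {i : ℤ} (hi : 0 ≤ i) (hj : i ≤ B.R) : 0 ≤ B.pt i := by
  rw [← B.pt_zero]; exact B.pt_le (by omega) hi hj

lemma pt_nonpos {i : ℤ} (hi : -(B.L : ℤ) ≤ i) (hj : i ≤ 0) : B.pt i ≤ 0 := by
  rw [← B.pt_zero]; exact B.pt_le hi hj (by omega)

lemma rightEnd_pos : 0 < B.rightEnd := by
  have := B.R_pos
  rw [← B.pt_zero]; exact B.pt_lt (by omega) (by omega) le_rfl

lemma leftEnd_neg : B.leftEnd < 0 := by
  have := B.L_pos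
  rw [← B.pt_zero]; exact B.pt_lt le_rfl (by omega) (by omega)

lemma exists_piece_nonneg {z : ℝ} (h0 : 0 ≤ z) (hz : z ≤ B.rightEnd) :
    ∃ i : ℕ, i < B.R ∧ B.pt i ≤ z ∧ z ≤ B.pt (i + 1) := by
  obtain ⟨i, hi, h⟩ := exists_mem_Icc_succ (f := fun i : ℕ => B.pt i) B.R_pos
    (by simpa [B.pt_zero] using h0) hz
  exact ⟨i, hi, by simpa using h⟩

lemma exists_piece_nonpos {z : ℝ} (h0 : z ≤ 0) (hz : B.leftEnd ≤ z) :
    ∃ i : ℕ, i < B.L ∧ B.pt (-(i : ℤ) - 1) ≤ z ∧ z ≤ B.pt (-(i : ℤ)) := by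
  obtain ⟨i, hi, h, h'⟩ := exists_mem_Icc_succ (f := fun i : ℕ => -B.pt (-(i : ℤ))) (z := -z)
    B.L_pos (by simpa [B.pt_zero] using h0) (by simpa [leftEnd] using hz)
  refine ⟨i, hi, ?_, by linarith⟩
  have e : (-(i : ℤ) - 1) = -((i + 1 : ℕ) : ℤ) := by push_cast; ring
  rw [e]; linarith

lemma outer_of_nonneg {z : ℝ} (hz : 0 ≤ z) : B.outer z =
    min 1 (⨅ i : Fin (B.R + 1), (B.tanSlope (i : ℕ) * z + B.tanIcpt (i : ℕ))) := if_pos hz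

lemma outer_of_neg {z : ℝ} (hz : z < 0) : B.outer z = max (Phi B.leftEnd)
    (⨆ i : Fin B.L, (B.secSlope (-(i : ℕ)) * z + B.secIcpt (-(i : ℕ)))) := if_neg hz.not_ge

lemma inner_of_nonneg {z : ℝ} (hz : 0 ≤ z) : B.inner z = min (Phi B.rightEnd)
    (⨅ i : Fin B.R, (B.secSlope ((i : ℕ) + 1) * z + B.secIcpt ((i : ℕ) + 1))) := if_pos hz

lemma inner_of_neg {z : ℝ} (hz : z < 0) : B.inner z =
    max 0 (⨆ i : Fin (B.L + 1), (B.tanSlope (-(i : ℕ)) * z + B.tanIcpt (-(i : ℕ)))) :=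
  if_neg hz.not_ge

/-- A mesh of width at most `√τ` covering all but `τ` of the mass in each tail is accurate. -/
lemma outerAccurate_of_mesh {τ : ℝ} (ht : B.TailsWithin τ)
    (hmesh : ∀ i : ℤ, -(B.L : ℤ) ≤ i → i < B.R → (B.pt (i + 1) - B.pt i) ^ 2 ≤ τ) :
    B.OuterAccurate τ := by
  refine ⟨ht, fun z => ?_⟩
  have hR : 1 - Phi B.rightEnd ≤ τ := (le_max_left _ _).trans ht
  have hL : Phi B.leftEnd ≤ τ := (le_max_right _ _).trans ht
  have hLpos : Nonempty (Fin B.L) := ⟨⟨0, B.L_pos⟩⟩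
  rcases le_or_gt 0 z with hz | hz
  · rw [B.outer_of_nonneg hz]
    constructor
    · rw [sub_nonneg]
      refine le_min (Phi_le_one z) (le_ciInf fun i => ?_)
      rw [tan_eq]
      exact Phi_le_tangent (B.pt_nonneg (by omega) (by have := i.2; omega)) hz
    · rw [sub_le_iff_le_add]
      rcases le_total z B.rightEnd with h | h
      · obtain ⟨i, hi, h1, h2⟩ := B.exists_piece_nonneg hz h
        refine (min_le_right _ _).trans
          ((ciInf_le (finite_range _).bddBelow (⟨i, by omega⟩ : Fin (B.R + 1))).trans ?_)
        rw [tan_eq]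
        have h3 := abs_le.1 (abs_Phi_sub_tangent_le (B.pt i) z)
        have h4 := hmesh i (by omega) (by omega)
        have h5 : (z - B.pt i) ^ 2 ≤ (B.pt (i + 1) - B.pt i) ^ 2 :=
          pow_le_pow_left₀ (by linarith) (by linarith) 2
        linarith [h3.1]
      · have := Phi_strictMono.monotone h
        exact (min_le_left _ _).trans (by linarith)
  · rw [B.outer_of_neg hz]
    have hlt (i : Fin B.L) : B.pt (-((i : ℕ) : ℤ) - 1) < B.pt (-((i : ℕ) : ℤ)) :=
      B.pt_lt (by have := i.2; omega) (by omega) (by omega)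
    have hnp (i : Fin B.L) : B.pt (-((i : ℕ) : ℤ)) ≤ 0 :=
      B.pt_nonpos (by have := i.2; omega) (by omega)
    constructor
    · rw [sub_nonneg]
      rcases le_total z B.leftEnd with h | h
      · exact (Phi_strictMono.monotone h).trans (le_max_left _ _)
      · obtain ⟨i, hi, h1, h2⟩ := B.exists_piece_nonpos hz.le h
        refine le_max_of_le_right
          (le_trans ?_ (le_ciSup (finite_range _).bddAbove (⟨i, hi⟩ : Fin B.L)))
        rw [sec_eq]
        exact Phi_le_secant (hlt ⟨i, hi⟩) (hnp ⟨i, hi⟩) ⟨h1, h2⟩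
    · rw [sub_le_iff_le_add]
      refine max_le (by linarith [Phi_nonneg z]) (ciSup_le fun i => ?_)
      rw [sec_eq]
      by_cases h : z ≤ B.pt (-((i : ℕ) : ℤ) - 1) ∨ B.pt (-((i : ℕ) : ℤ)) ≤ z
      · have := secant_le_Phi_of_notMem (hlt i) (hnp i) hz.le h
        linarith [Phi_nonneg B.leftEnd]
      · push Not at h
        have h3 := abs_le.1 (abs_Phi_sub_secant_le (hlt i) ⟨h.1.le, h.2.le⟩)
        have h4 := hmesh (-((i : ℕ) : ℤ) - 1) (by have := i.2; omega) (by omega)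
        rw [sub_add_cancel] at h4
        linarith [h3.1]

/-- Tangents and secants exchange roles with respect to the outer approximation; the second-order
errors are the same. -/
lemma innerAccurate_of_mesh {τ : ℝ} (ht : B.TailsWithin τ)
    (hmesh : ∀ i : ℤ, -(B.L : ℤ) ≤ i → i < B.R → (B.pt (i + 1) - B.pt i) ^ 2 ≤ τ) :
    B.InnerAccurate τ := by
  refine ⟨ht, fun z => ?_⟩
  have hR : 1 - Phi B.rightEnd ≤ τ := (le_max_left _ _).trans ht
  have hL : Phi B.leftEnd ≤ τ := (le_max_right _ _).trans ht
  have hRpos : Nonempty (Fin B.R) := ⟨⟨0, B.R_pos⟩⟩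
  rcases le_or_gt 0 z with hz | hz
  · rw [B.inner_of_nonneg hz]
    have hlt (i : Fin B.R) : B.pt ((i : ℕ) : ℤ) < B.pt (((i : ℕ) : ℤ) + 1) :=
      B.pt_lt (by omega) (by omega) (by have := i.2; omega)
    have hnn (i : Fin B.R) : 0 ≤ B.pt ((i : ℕ) : ℤ) :=
      B.pt_nonneg (by omega) (by have := i.2; omega)
    constructor
    · rw [sub_nonneg]
      rcases le_total z B.rightEnd with h | h
      · obtain ⟨i, hi, h1, h2⟩ := B.exists_piece_nonneg hz h
        refine min_le_of_right_le
          ((ciInf_le (finite_range _).bddBelow (⟨i, hi⟩ : Fin B.R)).trans ?_)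
        rw [sec_eq, add_sub_cancel_right]
        exact secant_le_Phi (hlt ⟨i, hi⟩) (hnn ⟨i, hi⟩) ⟨h1, h2⟩
      · exact (min_le_left _ _).trans (Phi_strictMono.monotone h)
    · rw [sub_le_iff_le_add, ← sub_le_iff_le_add']
      refine le_min (by linarith [Phi_le_one z]) (le_ciInf fun i => ?_)
      rw [sec_eq, add_sub_cancel_right]
      by_cases h : z ≤ B.pt ((i : ℕ) : ℤ) ∨ B.pt (((i : ℕ) : ℤ) + 1) ≤ z
      · have := Phi_le_secant_of_notMem (hlt i) (hnn i) hz h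
        linarith [Phi_nonneg B.leftEnd]
      · push Not at h
        have h3 := abs_le.1 (abs_Phi_sub_secant_le (hlt i) ⟨h.1.le, h.2.le⟩)
        have h4 := hmesh ((i : ℕ) : ℤ) (by omega) (by have := i.2; omega)
        linarith [h3.2]
  · rw [B.inner_of_neg hz]
    constructor
    · rw [sub_nonneg]
      refine max_le (Phi_nonneg z) (ciSup_le fun i => ?_)
      rw [tan_eq]
      exact tangent_le_Phi (B.pt_nonpos (by have := i.2; omega) (by omega)) hz.le
    · rw [sub_le_iff_le_add, ← sub_le_iff_le_add']
      rcases le_total z B.leftEnd with h | h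
      · have := Phi_strictMono.monotone h
        exact le_max_of_le_left (by linarith)
      · obtain ⟨i, hi, h1, h2⟩ := B.exists_piece_nonpos hz.le h
        refine le_max_of_le_right
          (le_trans ?_ (le_ciSup (finite_range _).bddAbove (⟨i, by omega⟩ : Fin (B.L + 1))))
        rw [tan_eq]
        have h3 := abs_le.1 (abs_Phi_sub_tangent_le (B.pt (-(i : ℤ))) z)
        have h4 := hmesh (-(i : ℤ) - 1) (by omega) (by omega)
        rw [sub_add_cancel] at h4
        have h5 : (B.pt (-(i : ℤ)) - z) ^ 2 ≤ (B.pt (-(i : ℤ)) - B.pt (-(i : ℤ) - 1)) ^ 2 :=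
          pow_le_pow_left₀ (by linarith) (by linarith) 2
        linarith [h3.2, sub_sq_comm z (B.pt (-(i : ℤ)))]

/-- The equidistant array with spacing `s` and `N` breakpoints on each side of the origin. -/
noncomputable def uniform (N : ℕ) (s : ℝ) (hN : 0 < N) (hs : 0 < s) : Breakpoints where
  L := N
  R := N
  L_pos := hN
  R_pos := hN
  pt i := i * s
  pt_zero := by simp
  pt_strictMono := fun i _ j _ hij => by
    have : (i : ℝ) < j := by exact_mod_cast hij
    exact mul_lt_mul_of_pos_right this hs

/-- `O(√((1/τ) log (1/τ)))` breakpoints suffice for accuracy `τ`. -/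
lemma exists_accurate {τ : ℝ} (h0 : 0 < τ) (h1 : τ ≤ Real.exp (-1)) :
    ∃ B : Breakpoints, B.OuterAccurate τ ∧ B.InnerAccurate τ ∧
      (B.count : ℝ) ≤ 6 * √(1 / τ * Real.log (1 / τ)) := by
  set l := Real.log (1 / τ) with hl
  have hl' : l = -Real.log τ := by rw [hl, one_div, Real.log_inv]
  have hl1 : 1 ≤ l := by
    have := Real.log_le_log h0 h1
    rw [Real.log_exp] at this
    linarith
  have hτ1 : 1 ≤ 1 / τ := by
    rw [le_div_iff₀ h0]
    have : Real.exp (-1) ≤ 1 := Real.exp_le_one_iff.2 (by norm_num)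
    linarith
  -- Spacing √τ makes the squared mesh width τ; the half-length M below is chosen so that exp(-M²/2)
  -- = τ.
  set s := √τ with hs
  have hs0 : 0 < s := Real.sqrt_pos.2 h0
  have hss : s ^ 2 = τ := Real.sq_sqrt h0.le
  set M := √(2 * l) with hM
  have hM0 : 0 < M := Real.sqrt_pos.2 (by linarith)
  have hMM : M ^ 2 = 2 * l := Real.sq_sqrt (by linarith)
  set N := ⌈M / s⌉₊ with hN
  have hN0 : 0 < N := Nat.ceil_pos.2 (by positivity)
  have hNM : M ≤ N * s := by
    rw [← div_le_iff₀ hs0]; exact Nat.le_ceil _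
  have hexp : Phi (-M) ≤ τ := by
    refine (Phi_neg_le_exp hM0.le).trans ?_
    rw [hMM, hl']
    rw [show -(2 * -Real.log τ) / 2 = Real.log τ by ring, Real.exp_log h0]
  have hPhi : Phi (-(N * s)) ≤ τ :=
    (Phi_strictMono.monotone (by linarith)).trans hexp
  let B := uniform N s hN0 hs0
  have htails : B.TailsWithin τ := by
    have e1 : B.rightEnd = N * s := by simp [B, rightEnd, uniform]
    have e2 : B.leftEnd = -(N * s) := by simp [B, leftEnd, uniform]
    rw [TailsWithin, e1, e2, ← Phi_neg]
    exact max_le hPhi hPhi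
  have hmesh : ∀ i : ℤ, -(B.L : ℤ) ≤ i → i < B.R → (B.pt (i + 1) - B.pt i) ^ 2 ≤ τ := by
    intro i _ _
    have : B.pt (i + 1) - B.pt i = s := by simp [B, uniform]; ring
    rw [this, hss]
  refine ⟨B, B.outerAccurate_of_mesh htails hmesh, B.innerAccurate_of_mesh htails hmesh, ?_⟩
  have hc : (B.count : ℝ) = 2 * N + 1 := by simp [B, count, uniform]; ring
  have hN1 : (N : ℝ) < M / s + 1 := Nat.ceil_lt_add_one (by positivity)
  set Q := √(1 / τ * l) with hQ
  have hQ1 : 1 ≤ Q := by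
    rw [hQ, Real.one_le_sqrt]
    nlinarith
  -- M / s = √2 Q. The constant 6 arises from 2N + 1 < 2M/s + 3 ≤ 3Q + 3Q, where 1 ≤ Q relies on τ ≤
  -- 1/e.
  have hMs : M / s ≤ 3 / 2 * Q := by
    rw [hM, hs, hQ, ← Real.sqrt_div (by linarith)]
    refine Real.sqrt_le_iff.2 ⟨by positivity, ?_⟩
    rw [mul_pow, Real.sq_sqrt (by positivity)]
    have : 0 ≤ l / τ := by positivity
    have e : 1 / τ * l = l / τ := by ring
    have e' : 2 * l / τ = 2 * (l / τ) := by ring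
    rw [e, e']
    linarith
  rw [hc]
  linarith

end Breakpoints

/-! ### The mixed-binary sets compared with the graph of `Phi` -/

section PiecewiseLinear

variable {B : Breakpoints} {lo up τ z ζ q : ℝ}

namespace Breakpoints

lemma TailsWithin.left (h : B.TailsWithin τ) : Phi B.leftEnd ≤ τ := (le_max_right _ _).trans h

lemma TailsWithin.right (h : B.TailsWithin τ) : 1 - τ ≤ Phi B.rightEnd := by
  have := (le_max_left _ _).trans h
  linarith

lemma TailsWithin.nonneg (h : B.TailsWithin τ) : 0 ≤ τ := (Phi_nonneg _).trans h.left

lemma OuterAccurate.secant_le (h : B.OuterAccurate τ) {i : ℕ} (hi : i < B.L) (hz : z < 0) :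
    secant (B.pt (-(i : ℤ) - 1)) (B.pt (-(i : ℤ))) z ≤ Phi z + τ := by
  have h1 := (h.2 z).2
  rw [B.outer_of_neg hz] at h1
  have h2 := le_ciSup (finite_range fun i : Fin B.L =>
    (B.secSlope (-(i : ℕ)) * z + B.secIcpt (-(i : ℕ)))).bddAbove ⟨i, hi⟩
  rw [sec_eq] at h2
  linarith [h2.trans (le_max_right (Phi B.leftEnd) _)]

/-- In the inner system, selecting tangent i forces z to be at least the next breakpoint on the
left. Take the leftmost τ-accurate tangent at z. If z were left of that next breakpoint, convexity
would make the tangent there at least as good, contradicting the choice. The last index L is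
excluded because its tangent, already at 0, is below `Phi M - τ`. -/
lemma exists_tangent_index (h : B.InnerAccurate τ) {M : ℝ} (hM : τ < Phi M)
    (hleft : Phi B.leftEnd + phi B.leftEnd * -B.leftEnd < Phi M - τ) (hz : z < 0) (hMz : M ≤ z) :
    ∃ i : ℕ, i < B.L ∧ B.pt (-(i : ℤ) - 1) ≤ z ∧
      Phi z - τ ≤ Phi (B.pt (-(i : ℤ))) + phi (B.pt (-(i : ℤ))) * (z - B.pt (-(i : ℤ))) := by
  set T : ℕ → ℝ := fun i => Phi (B.pt (-(i : ℤ))) + phi (B.pt (-(i : ℤ))) * (z - B.pt (-(i : ℤ)))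
    with hT
  have hPhi : Phi M ≤ Phi z := Phi_strictMono.monotone hMz
  have hex : ∃ i : ℕ, i ≤ B.L ∧ Phi z - τ ≤ T i := by
    by_contra! hcon
    have h1 := (h.2 z).2
    rw [B.inner_of_neg hz] at h1
    obtain ⟨i, hi⟩ := exists_eq_ciSup_of_finite (f := fun i : Fin (B.L + 1) =>
      (B.tanSlope (-(i : ℕ)) * z + B.tanIcpt (-(i : ℕ))))
    rw [← hi, B.tan_eq] at h1
    have h2 := hcon i (by omega)
    have h3 : max 0 (T i) < Phi z - τ := max_lt (by linarith) h2
    simp only [hT] at h3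
    linarith
  have hL : ¬ Phi z - τ ≤ T B.L := by
    have e : T B.L = Phi B.leftEnd + phi B.leftEnd * (z - B.leftEnd) := rfl
    rw [e]
    nlinarith [phi_pos B.leftEnd]
  have hfind := Nat.findGreatest_spec (P := fun i => Phi z - τ ≤ T i) hex.choose_spec.1
    hex.choose_spec.2
  have hle : Nat.findGreatest (fun i => Phi z - τ ≤ T i) B.L ≤ B.L := Nat.findGreatest_le _
  have hgr := fun k => Nat.findGreatest_is_greatest (P := fun i => Phi z - τ ≤ T i) (n := B.L)
    (k := k)
  generalize Nat.findGreatest (fun i => Phi z - τ ≤ T i) B.L = i at hfind hle hgr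
  have hlt : i < B.L := lt_of_le_of_ne hle fun h => hL (h ▸ hfind)
  refine ⟨i, hlt, ?_, hfind⟩
  by_contra! hcon
  have e : (-(i : ℤ) - 1) = -((i + 1 : ℕ) : ℤ) := by push_cast; ring
  rw [e] at hcon
  refine hgr (i + 1) i.lt_succ_self hlt (hfind.trans ?_)
  have ha : B.pt (-((i + 1 : ℕ) : ℤ)) ≤ 0 := B.pt_nonpos (by omega) (by omega)
  have hb : B.pt (-(i : ℤ)) ≤ 0 := B.pt_nonpos (by omega) (by omega)
  have h1 := tangent_le_Phi hb ha
  have h2 : phi (B.pt (-((i + 1 : ℕ) : ℤ))) ≤ phi (B.pt (-(i : ℤ))) :=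
    phi_monotoneOn ha hb (B.pt_le (by omega) (by omega) (by omega))
  simp only [hT]
  nlinarith

/-- The threshold is uniform over arrays, since τ is fixed before them. Small tails push the left
end so far out that its tangent is below `Phi M / 2` at 0, and τ takes at most the other half. -/
lemma exists_tails_threshold (M : ℝ) : ∃ τ₁ > 0, τ₁ < Phi M ∧ ∀ τ ≤ τ₁, ∀ B : Breakpoints,
    B.TailsWithin τ → B.leftEnd ≤ M ∧
      Phi B.leftEnd + phi B.leftEnd * -B.leftEnd < Phi M - τ := by
  have h := Phi_tangent_zero_tendsto_atBot.eventually (gt_mem_nhds (half_pos (Phi_pos M)))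
  obtain ⟨M', hM'⟩ := eventually_atBot.1 h
  have hpos : 0 < Phi (min M M') := Phi_pos _
  have hle : Phi (min M M') ≤ Phi M := Phi_strictMono.monotone (min_le_left _ _)
  refine ⟨Phi (min M M') / 2, half_pos hpos, by linarith, fun τ hτ B hB => ?_⟩
  have h1 : B.leftEnd < min M M' := Phi_strictMono.lt_iff_lt.1 (by linarith [hB.left])
  have h2 := hM' B.leftEnd (h1.le.trans (min_le_right _ _))
  exact ⟨h1.le.trans (min_le_left _ _), by linarith⟩

end Breakpoints

/-- Exactly one t is 1. The first leaves ζ at most the left tail mass; the second makes z and the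
bound on ζ the same convex combination along one secant; the third gives z ≥ 0 and ζ ≤ `B.outer z`.
-/
lemma MemOuterSet.le_Phi_add (hB : B.OuterAccurate τ) {α : Fin (B.L + 1) → ℝ} {t y : Fin 3 → ℝ}
    (h : MemOuterSet B lo up α t y z ζ) : ζ ≤ Phi z + τ := by
  obtain ⟨hα, ht, h1, h2, hsum, hz, hy0, hy0', hy2, hy2', hy1, ht1, j, hj⟩ := h
  have hτ := hB.1.nonneg
  rcases ht 2 with t2 | t2
  · have y2 : y 2 = 0 := le_antisymm (by rw [t2] at hy2'; linarith) hy2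
    rcases ht 0 with t0 | t0
    · have t1 : t 1 = 1 := by linarith
      have y0 : y 0 = 0 := le_antisymm (by rw [t0] at hy0'; linarith) (by rw [t0] at hy0; linarith)
      rw [t0, t2, mul_zero, zero_add, add_zero] at h2
      rw [y0, y2, zero_add, add_zero] at hz
      rw [← hz] at hy1
      rw [t1] at ht1
      -- The SOS2 index j is not bounded by definition: j = L leaves only the last weight, and j > L
      -- leaves none, against total weight 1.
      rcases lt_trichotomy j B.L with hjL | hjL | hjL
      · have hsum2 : ∀ f : Fin (B.L + 1) → ℝ, ∑ i, α i * f i =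
            α ⟨j, by omega⟩ * f ⟨j, by omega⟩ + α ⟨j + 1, by omega⟩ * f ⟨j + 1, by omega⟩ := by
          intro f
          refine Fintype.sum_eq_add _ _ (by simp [Fin.ext_iff]) fun i hi => ?_
          by_contra hne
          rcases hj i (left_ne_zero_of_mul hne) with h | h
          · exact hi.1 (Fin.ext h)
          · exact hi.2 (Fin.ext h)
        have hs1 := hsum2 fun _ => 1
        simp only [mul_one] at hs1
        rw [hsum2] at h2 hy1
        rw [hs1] at ht1
        have ha := hα ⟨j, by omega⟩
        have hb := hα ⟨j + 1, by omega⟩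
        simp only at h2 hy1
        have e : -((j + 1 : ℕ) : ℤ) = -(j : ℤ) - 1 := by push_cast; ring
        rw [e] at h2 hy1
        set a := α ⟨j, by omega⟩
        set b := α ⟨j + 1, by omega⟩
        have hlt : B.pt (-(j : ℤ) - 1) < B.pt (-(j : ℤ)) := B.pt_lt (by omega) (by omega) (by omega)
        have hnp : B.pt (-(j : ℤ)) ≤ 0 := B.pt_nonpos (by omega) (by omega)
        have hval : a * Phi (B.pt (-(j : ℤ))) + b * Phi (B.pt (-(j : ℤ) - 1)) =
            secant (B.pt (-(j : ℤ) - 1)) (B.pt (-(j : ℤ))) z := by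
          have hne : B.pt (-(j : ℤ)) - B.pt (-(j : ℤ) - 1) ≠ 0 := sub_ne_zero.2 hlt.ne'
          have e1 : z - B.pt (-(j : ℤ) - 1) = a * (B.pt (-(j : ℤ)) - B.pt (-(j : ℤ) - 1)) := by
            have : b = 1 - a := by linarith
            rw [hy1, this]; ring
          rw [secant, e1]
          have : b = 1 - a := by linarith
          rw [this]
          field_simp
          ring
        rw [hval] at h2
        -- Accuracy speaks of secants only for z < 0. On this piece z ≥ 0 forces z to be its right
        -- end, where secant and `Phi` agree.
        rcases lt_or_ge z 0 with hz0 | hz0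
        · exact h2.trans (hB.secant_le hjL hz0)
        · have hzr : z = B.pt (-(j : ℤ)) := by
            have : b = 1 - a := by linarith
            nlinarith
          rw [hzr, secant_right hlt] at h2
          rw [hzr]
          linarith
      · have hsum2 : ∀ f : Fin (B.L + 1) → ℝ, ∑ i, α i * f i =
            α ⟨j, by omega⟩ * f ⟨j, by omega⟩ := by
          intro f
          refine Fintype.sum_eq_single _ fun i hi => ?_
          by_contra hne
          rcases hj i (left_ne_zero_of_mul hne) with h | h
          · exact hi (Fin.ext h)
          · have := i.2; omega
        have hs1 := hsum2 fun _ => 1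
        simp only [mul_one] at hs1
        rw [hsum2] at h2 hy1
        rw [hs1] at ht1
        rw [← ht1, one_mul] at h2 hy1
        rw [hy1]
        linarith
      · have : ∑ i, α i = 0 := Finset.sum_eq_zero fun i _ => by
          by_contra hne
          have := hj i hne
          have := i.2
          omega
        linarith
    · have t1 : t 1 = 0 := by linarith
      have hα0 : ∀ i, α i = 0 := by
        have := (Finset.sum_eq_zero_iff_of_nonneg fun i _ => hα i).1 (ht1.symm.trans t1)
        exact fun i => this i (Finset.mem_univ i)
      simp only [hα0, zero_mul, Finset.sum_const_zero, t0, t2] at h2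
      linarith [hB.1.left, Phi_nonneg z]
  · have t01 : t 0 = 0 ∧ t 1 = 0 := by
      rcases ht 0 with h | h <;> rcases ht 1 with h' | h' <;> constructor <;> linarith
    obtain ⟨t0, t1⟩ := t01
    have y0 : y 0 = 0 := le_antisymm (by rw [t0] at hy0'; linarith) (by rw [t0] at hy0; linarith)
    have hα0 : ∀ i, α i = 0 := by
      have := (Finset.sum_eq_zero_iff_of_nonneg fun i _ => hα i).1 (ht1.symm.trans t1)
      exact fun i => this i (Finset.mem_univ i)
    simp only [hα0, zero_mul, Finset.sum_const_zero] at hy1 h2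
    have hzy : z = y 2 := by linarith
    have hz0 : 0 ≤ z := hzy ▸ hy2
    have hle : ζ ≤ B.outer z := by
      rw [B.outer_of_nonneg hz0]
      refine le_min (by rw [t0, t2] at h2; linarith) (le_ciInf fun i => ?_)
      have := h1 i
      rw [t0, t1, t2, ← hzy] at this
      linarith
    linarith [(hB.2 z).2]

/-- There is no loss of τ: tangents at nonpositive breakpoints lie below `Phi` on the negative side,
and the right piece is constant. Accuracy is needed only for the secants. -/
lemma MemInnerSet.le_Phi (hB : B.InnerAccurate τ) {α v : Fin B.L → ℝ} {t y : Fin 4 → ℝ}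
    (h : MemInnerSet B lo up α v t y z ζ) : ζ ≤ Phi z := by
  obtain ⟨hα, ht, h1, h2, -, hsum, hz, hy0, hy0', ht1, hv, hy1, hy2, hy2', hy3, hy3'⟩ := h
  have t_nonneg (j) : 0 ≤ t j := by rcases ht j with h | h <;> linarith
  have α_nonneg (i) : 0 ≤ α i := by rcases hα i with h | h <;> linarith
  have hα0 (h : t 1 = 0) : ∀ i, α i = 0 := by
    have := (Finset.sum_eq_zero_iff_of_nonneg fun i _ => α_nonneg i).1 (ht1.symm.trans h)
    exact fun i => this i (Finset.mem_univ i)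
  have hv0 (i) (h : α i = 0) : v i = 0 := by
    have := hv i
    rw [h] at this
    exact le_antisymm this.2 (by linarith [this.1])
  have hy0_zero (h : t 0 = 0) : y 0 = 0 := by
    rw [h, mul_zero] at hy0 hy0'; exact le_antisymm hy0' hy0
  have hy2_zero (h : t 2 = 0) : y 2 = 0 := by
    rw [h, mul_zero] at hy2'; exact le_antisymm hy2' hy2
  have hy3_zero (h : t 3 = 0) : y 3 = 0 := by
    rw [h, mul_zero] at hy3 hy3'; exact le_antisymm hy3' hy3
  have hy1_zero (h : t 1 = 0) : y 1 = 0 := by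
    rw [hy1]; exact Finset.sum_eq_zero fun i _ => hv0 i (hα0 h i)
  have hsum_zero (h : t 1 = 0) :
      ∑ i : Fin B.L, (B.tanSlope (-(i : ℕ)) * v i + B.tanIcpt (-(i : ℕ)) * α i) = 0 :=
    Finset.sum_eq_zero fun i _ => by rw [hα0 h i, hv0 i (hα0 h i)]; ring
  have n0 := t_nonneg 0
  have n1 := t_nonneg 1
  have n2 := t_nonneg 2
  have n3 := t_nonneg 3
  rcases ht 0 with t0 | t0
  · have y0 := hy0_zero t0
    rcases ht 1 with t1 | t1
    · have y1 := hy1_zero t1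
      have s0 := hsum_zero t1
      rcases ht 2 with t2 | t2
      · have t3 : t 3 = 1 := by linarith
        have y2 := hy2_zero t2
        have hzy : z = y 3 := by linarith
        rw [t3, mul_one, ← hzy] at hy3
        rw [s0, y0, t0, t2, t3] at h2
        linarith [Phi_strictMono.monotone hy3]
      · have t3 : t 3 = 0 := by linarith
        have y3 := hy3_zero t3
        have hzy : z = y 2 := by linarith
        have hz0 : 0 ≤ z := hzy ▸ hy2
        have hRpos : Nonempty (Fin B.R) := ⟨⟨0, B.R_pos⟩⟩
        have hS (i : Fin B.R) : ζ ≤ B.secSlope ((i : ℕ) + 1) * z + B.secIcpt ((i : ℕ) + 1) := by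
          have := h1 i
          rw [t0, t1, t2, t3, ← hzy] at this
          linarith
        have hinf : ζ ≤ ⨅ i : Fin B.R,
            (B.secSlope ((i : ℕ) + 1) * z + B.secIcpt ((i : ℕ) + 1)) := le_ciInf hS
        have hin := (hB.2 z).1
        rw [B.inner_of_nonneg hz0] at hin
        -- Accuracy bounds only the minimum with `Phi B.rightEnd`. If that constant is the minimum,
        -- z must equal the right end, where the last secant meets `Phi`.
        rcases min_cases (Phi B.rightEnd) (⨅ i : Fin B.R,
            (B.secSlope ((i : ℕ) + 1) * z + B.secIcpt ((i : ℕ) + 1))) with ⟨hm, -⟩ | ⟨hm, -⟩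
        · rw [hm] at hin
          have hzR : z = B.rightEnd := by
            refine le_antisymm (by rw [t2] at hy2'; linarith) ?_
            exact Phi_strictMono.le_iff_le.1 (by linarith)
          have hR := B.R_pos
          have := hS ⟨B.R - 1, by omega⟩
          have e : (((B.R - 1 : ℕ) : ℤ) + 1) = B.R := by omega
          rw [B.sec_eq] at this
          simp only [e] at this
          rw [hzR] at this
          rw [hzR]
          rwa [Breakpoints.rightEnd,
            secant_right (B.pt_lt (by omega) (by omega) (by omega))] at this
        · rw [hm] at hin
          linarith
    · have t2 : t 2 = 0 := by linarith
      have t3 : t 3 = 0 := by linarith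
      have y2 := hy2_zero t2
      have y3 := hy3_zero t3
      obtain ⟨j, hj⟩ : ∃ j, α j = 1 := by
        by_contra! hcon
        have : ∑ i, α i = 0 := Finset.sum_eq_zero fun i _ => (hα i).resolve_right (hcon i)
        linarith
      have hother : ∀ i, i ≠ j → α i = 0 := by
        have hs := Finset.add_sum_erase Finset.univ α (Finset.mem_univ j)
        rw [hj, ← ht1, t1] at hs
        have := (Finset.sum_eq_zero_iff_of_nonneg (s := Finset.univ.erase j)
          fun i _ => α_nonneg i).1 (by linarith)
        exact fun i hi => this i (Finset.mem_erase.2 ⟨hi, Finset.mem_univ i⟩)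
      have hs1 : ∑ i, v i = v j := Fintype.sum_eq_single _ fun i hi => hv0 i (hother i hi)
      have hs2 : ∑ i : Fin B.L, (B.tanSlope (-(i : ℕ)) * v i + B.tanIcpt (-(i : ℕ)) * α i) =
          B.tanSlope (-(j : ℕ)) * v j + B.tanIcpt (-(j : ℕ)) * α j :=
        Fintype.sum_eq_single _ fun i hi => by rw [hother i hi, hv0 i (hother i hi)]; ring
      have hzv : z = v j := by linarith
      rw [hs2, ← hzv, hj, mul_one, B.tan_eq, y0, t0, t2, t3] at h2
      have := tangent_le_Phi (B.pt_nonpos (i := -((j : ℕ) : ℤ)) (by have := j.2; omega) (by omega))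
        (hzv ▸ (hv j).2)
      linarith
  · have t1 : t 1 = 0 := by linarith
    have t2 : t 2 = 0 := by linarith
    have t3 : t 3 = 0 := by linarith
    have y1 := hy1_zero t1
    have y2 := hy2_zero t2
    have y3 := hy3_zero t3
    have s0 := hsum_zero t1
    have hzy : z = y 0 := by linarith
    rw [s0, t0, t2, t3, mul_one, B.tan_eq, ← hzy] at h2
    rw [t0, mul_one, ← hzy] at hy0'
    have hl := B.leftEnd_neg
    have := tangent_le_Phi (B.pt_nonpos (i := -(B.L : ℤ)) (by omega) (by omega)) (hy0'.trans hl.le)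
    linarith

lemma exists_memOuterSet_of_nonneg (hup : z ≤ up) (hz : 0 ≤ z)
    (hζ : ζ ≤ Phi z) :
    ∃ α t y, MemOuterSet B lo up α t y z ζ := by
  refine ⟨fun _ => 0, ![0, 0, 1], ![0, 0, z], ?_⟩
  refine ⟨by simp, ?_, ?_, ?_, by simp, by simp, by simp, by simp, by simpa, by simpa, by simp,
    by simp, 0, by simp⟩
  · intro j; fin_cases j <;> simp [IsBinary]
  · intro i
    have h := B.tan_eq (i : ℕ) z
    have := Phi_le_tangent (B.pt_nonneg (i := ((i : ℕ) : ℤ)) (by omega) (by have := i.2; omega)) hz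
    simp only [Matrix.cons_val]
    linarith
  · simpa using hζ.trans (Phi_le_one z)

lemma exists_memOuterSet_of_neg (hz : z < 0) (hleft : B.leftEnd ≤ z) (hζ : ζ ≤ Phi z) :
    ∃ α t y, MemOuterSet B lo up α t y z ζ := by
  obtain ⟨j, hj, hj1, hj2⟩ := B.exists_piece_nonpos hz.le hleft
  have hlt : B.pt (-(j : ℤ) - 1) < B.pt (-(j : ℤ)) := B.pt_lt (by omega) (by omega) (by omega)
  have hnp : B.pt (-(j : ℤ)) ≤ 0 := B.pt_nonpos (by omega) (by omega)
  have hpos : 0 < B.pt (-(j : ℤ)) - B.pt (-(j : ℤ) - 1) := sub_pos.2 hlt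
  set a := (z - B.pt (-(j : ℤ) - 1)) / (B.pt (-(j : ℤ)) - B.pt (-(j : ℤ) - 1)) with ha
  have ha0 : 0 ≤ a := div_nonneg (by linarith) hpos.le
  have ha1 : a ≤ 1 := (div_le_one hpos).2 (by linarith)
  have haz : a * (B.pt (-(j : ℤ)) - B.pt (-(j : ℤ) - 1)) = z - B.pt (-(j : ℤ) - 1) :=
    div_mul_cancel₀ _ hpos.ne'
  let i₀ : Fin (B.L + 1) := ⟨j, by omega⟩
  let i₁ : Fin (B.L + 1) := ⟨j + 1, by omega⟩
  -- Barycentric coordinates of z between two adjacent breakpoints.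
  let α : Fin (B.L + 1) → ℝ := fun i => (if i = i₀ then a else 0) + if i = i₁ then 1 - a else 0
  have hsum (f : Fin (B.L + 1) → ℝ) : ∑ i, α i * f i = a * f i₀ + (1 - a) * f i₁ := by
    simp [α, add_mul, Finset.sum_add_distrib, ite_mul]
  have hsum1 : ∑ i, α i = 1 := by simpa using hsum fun _ => 1
  have hz' : z = ∑ i : Fin (B.L + 1), α i * B.pt (-((i : ℕ) : ℤ)) := by
    rw [hsum]
    have e : -((i₁ : ℕ) : ℤ) = -(j : ℤ) - 1 := by simp [i₁]; ring
    rw [e]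
    change z = a * B.pt (-(j : ℤ)) + _
    linarith
  refine ⟨α, ![0, 1, 0], ![0, z, 0], ?_⟩
  refine ⟨fun i => add_nonneg ?_ ?_, ?_, ?_, ?_, by simp, by simp, by simp, by simp, by simp,
    by simp, by simpa using hz', by simp [hsum1], j, fun i hi => ?_⟩
  · split_ifs <;> simp [ha0]
  · split_ifs <;> simp [ha1]
  · intro j; fin_cases j <;> simp [IsBinary]
  · intro i
    simpa using hζ.trans (Phi_le_one z)
  · have hP := Phi_le_secant hlt hnp ⟨hj1, hj2⟩
    rw [hsum]
    have e : -((i₁ : ℕ) : ℤ) = -(j : ℤ) - 1 := by simp [i₁]; ring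
    have e0 : -((i₀ : ℕ) : ℤ) = -(j : ℤ) := rfl
    rw [e, e0]
    have hs : secant (B.pt (-(j : ℤ) - 1)) (B.pt (-(j : ℤ))) z =
        a * Phi (B.pt (-(j : ℤ))) + (1 - a) * Phi (B.pt (-(j : ℤ) - 1)) := by
      rw [secant, ha]
      field_simp
      ring
    simp only [Matrix.cons_val]
    linarith
  · by_contra! hcon
    apply hi
    have h0 : i ≠ i₀ := fun h => hcon.1 (by rw [h])
    have h1 : i ≠ i₁ := fun h => hcon.2 (by rw [h])
    simp [α, h0, h1]

/-- Margins beyond `up` are replaced by `up`, which costs at most the right tail mass, hence at most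
τ. -/
lemma exists_memOuterSet (hB : B.OuterAccurate τ) (hup : B.rightEnd ≤ up) (hq : B.leftEnd ≤ q) :
    ∃ z ≤ q, ∃ α t y, MemOuterSet B lo up α t y z (Phi q - τ) := by
  have hR := B.rightEnd_pos
  rcases lt_or_ge q 0 with hq0 | hq0
  · exact ⟨q, le_rfl, exists_memOuterSet_of_neg hq0 hq (by linarith [hB.1.nonneg])⟩
  · refine ⟨min q up, min_le_left _ _,
      exists_memOuterSet_of_nonneg (min_le_right _ _) (le_min hq0 (by linarith)) ?_⟩
    rcases min_cases q up with ⟨h, -⟩ | ⟨h, -⟩ <;> rw [h]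
    · linarith [hB.1.nonneg]
    · linarith [hB.1.right, Phi_le_one q, Phi_strictMono.monotone hup]

/-- This serves x = 0, where λ = 0 leaves z unconstrained by a margin. -/
lemma exists_memOuterSet_up (hB : B.OuterAccurate τ) (hup : B.rightEnd ≤ up) :
    ∃ z, ∃ α t y, MemOuterSet B lo up α t y z (1 - τ) :=
  ⟨up, exists_memOuterSet_of_nonneg le_rfl (by linarith [B.rightEnd_pos])
    (by linarith [hB.1.right, Phi_strictMono.monotone hup])⟩

lemma exists_memInnerSet_of_rightEnd_le (hup : z ≤ up) (hz : B.rightEnd ≤ z)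
    (hζ : ζ ≤ Phi B.rightEnd) :
    ∃ α v t y, MemInnerSet B lo up α v t y z ζ := by
  refine ⟨fun _ => 0, fun _ => 0, ![0, 0, 0, 1], ![0, 0, 0, z], by simp [IsBinary], ?_, ?_, ?_,
    by simp, by simp, by simp, by simp, by simp, by simp, by simp, by simp, by simp, by simp,
    by simpa, by simpa⟩
  · intro j; fin_cases j <;> simp [IsBinary]
  · intro i; simpa
  · simpa

lemma exists_memInnerSet (hB : B.InnerAccurate τ) (hup : B.rightEnd ≤ up) {M : ℝ} (hM : τ < Phi M)
    (hleft : Phi B.leftEnd + phi B.leftEnd * -B.leftEnd < Phi M - τ) (hq : M ≤ q) :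
    ∃ z ≤ q, ∃ α v t y, MemInnerSet B lo up α v t y z (Phi q - τ) := by
  rcases lt_or_ge q 0 with hq0 | hq0
  · obtain ⟨j, hj, hj1, hj2⟩ := B.exists_tangent_index hB hM hleft hq0 hq
    have hnp : B.pt (-(j : ℤ) - 1) ≤ 0 := B.pt_nonpos (by omega) (by omega)
    let i₀ : Fin B.L := ⟨j, hj⟩
    have hsum (f g : Fin B.L → ℝ) :
        ∑ i, (f i * (Pi.single i₀ q : Fin B.L → ℝ) i + g i * (Pi.single i₀ 1 : Fin B.L → ℝ) i) =
          f i₀ * q + g i₀ := by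
      rw [Fintype.sum_eq_single i₀ fun i hi => by simp [hi]]
      simp
    refine ⟨q, le_rfl, Pi.single i₀ 1, Pi.single i₀ q, ![0, 1, 0, 0], ![0, q, 0, 0], ?_, ?_, ?_, ?_,
      by simp, by simp, by simp, by simp, by simp, by simp, ?_, by simp, by simp, by simp,
      by simp, by simp⟩
    · intro i
      by_cases h : i = i₀
      · subst h; simp [IsBinary]
      · simp [IsBinary, h]
    · intro j; fin_cases j <;> simp [IsBinary]
    · intro i
      simp only [Matrix.cons_val]
      linarith [Phi_le_one q, hB.1.nonneg]
    · rw [hsum]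
      have := B.tan_eq (-(j : ℤ)) q
      simp only [Matrix.cons_val, i₀]
      linarith
    · intro i
      by_cases h : i = i₀
      · subst h
        simp [i₀, hj1, hq0.le]
      · simp [h]
  · rcases le_total q B.rightEnd with hqR | hqR
    · refine ⟨q, le_rfl, fun _ => 0, fun _ => 0, ![0, 0, 1, 0], ![0, 0, q, 0], by simp [IsBinary],
        ?_, ?_, ?_, by simp, by simp, by simp, by simp, by simp, by simp, by simp, by simp,
        by simpa, by simpa, by simp, by simp⟩
      · intro j; fin_cases j <;> simp [IsBinary]
      · intro i
        have h := (hB.2 q).2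
        rw [B.inner_of_nonneg hq0] at h
        have h1 := (min_le_right (Phi B.rightEnd) _).trans (ciInf_le (finite_range fun i : Fin B.R =>
          (B.secSlope ((i : ℕ) + 1) * q + B.secIcpt ((i : ℕ) + 1))).bddBelow i)
        simp only [Matrix.cons_val]
        linarith
      · simp
        linarith [Phi_le_one q, hB.1.nonneg]
    · exact ⟨min q up, min_le_left _ _,
        exists_memInnerSet_of_rightEnd_le (min_le_right _ _) (le_min hqR hup) (by linarith [hB.1.right, Phi_le_one q])⟩

end PiecewiseLinear

/-! ### The probability function and its margins -/

lemma gaussianReal_real_Iic (m : ℝ) {σ : ℝ} (hσ : 0 < σ) (b : ℝ) :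
    (gaussianReal m (σ ^ 2).toNNReal).real (Iic b) = Phi ((b - m) / σ) := by
  have h1 : (gaussianReal 0 1).map (fun x => σ * x) = gaussianReal 0 (σ ^ 2).toNNReal := by
    rw [gaussianReal_map_const_mul]
    congr 1
    · simp
    · ext; simp [sq_nonneg]
  have h2 : ((gaussianReal 0 1).map (fun x => σ * x)).map (fun x => x + m) =
      gaussianReal m (σ ^ 2).toNNReal := by
    rw [h1, gaussianReal_map_add_const, zero_add]
  rw [← h2, map_measureReal_apply (by fun_prop) measurableSet_Iic,
    map_measureReal_apply (by fun_prop) (by measurability), Phi, cdf_eq_real]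
  congr 1
  ext x
  simp only [mem_preimage, mem_Iic]
  rw [le_div_iff₀ hσ, le_sub_iff_add_le, mul_comm]

section Gaussian

variable {n : ℕ}

lemma map_inner_multivariateGaussian (m : EuclideanSpace ℝ (Fin n))
    {V : Matrix (Fin n) (Fin n) ℝ} (hS : V.PosSemidef) (x : EuclideanSpace ℝ (Fin n)) :
    (multivariateGaussian m V).map (fun ξ => inner ℝ ξ x) =
      gaussianReal (inner ℝ x m) (x.ofLp ⬝ᵥ (V *ᵥ x.ofLp)).toNNReal := by
  have h := IsGaussian.map_eq_gaussianReal (μ := multivariateGaussian m V) (innerSL ℝ x)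
  have e : (fun ξ : EuclideanSpace ℝ (Fin n) => inner ℝ ξ x) = innerSL ℝ x := by
    funext ξ; simp [real_inner_comm]
  rw [e, h]
  congr 1
  · rw [(innerSL ℝ x).integral_comp_id_comm IsGaussian.integrable_id]
    simp
  · rw [← covarianceBilin_multivariateGaussian (μ := m) hS x x, covarianceBilin_self]
    · rfl
    · exact IsGaussian.memLp_two_id

end Gaussian

namespace Problem

variable {n K mE mI : ℕ} {S : Problem n K mE mI} {θ : ℝ}

/-- The standardized margin of `ξᵀ x ≤ b` under the `k`-th component. -/
noncomputable def margin (S : Problem n K mE mI) (k : Fin K) (x : EuclideanSpace ℝ (Fin n)) : ℝ :=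
  (S.b - inner ℝ x (S.mu k)) / √(x.ofLp ⬝ᵥ (S.Sig k *ᵥ x.ofLp))

lemma p_eq_sum (x : EuclideanSpace ℝ (Fin n)) (hw : S.WeightsValid) : S.p x =
    ∑ k, S.w k * (multivariateGaussian (S.mu k) (S.Sig k)).real {ξ | inner ℝ ξ x ≤ S.b} := by
  rw [p, law, measureReal_def, Measure.finsetSum_apply, ENNReal.toReal_sum]
  · refine Finset.sum_congr rfl fun k _ => ?_
    rw [Measure.smul_apply, smul_eq_mul, ENNReal.toReal_mul, ENNReal.toReal_ofReal (hw.1 k),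
      measureReal_def]
  · intro k _
    rw [Measure.smul_apply, smul_eq_mul]
    exact ENNReal.mul_ne_top ENNReal.ofReal_ne_top (measure_ne_top _ _)

lemma p_le_one (hw : S.WeightsValid) (x : EuclideanSpace ℝ (Fin n)) : S.p x ≤ 1 := by
  rw [p_eq_sum x hw, ← hw.2]
  exact Finset.sum_le_sum fun k _ => mul_le_of_le_one_right (hw.1 k) measureReal_le_one

lemma p_zero_of_nonneg (hw : S.WeightsValid) (hb : 0 ≤ S.b) : S.p 0 = 1 := by
  rw [p_eq_sum 0 hw, ← hw.2]
  refine Finset.sum_congr rfl fun k _ => ?_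
  simp [hb]

lemma p_zero_of_neg (hw : S.WeightsValid) (hb : S.b < 0) : S.p 0 = 0 := by
  rw [p_eq_sum 0 hw]
  refine Finset.sum_eq_zero fun k _ => ?_
  simp [hb.not_ge]

lemma quad_pos (hS : ∀ k, (S.Sig k).PosDef) (k : Fin K) {x : EuclideanSpace ℝ (Fin n)}
    (hx : x ≠ 0) : 0 < x.ofLp ⬝ᵥ (S.Sig k *ᵥ x.ofLp) := by
  have h := (hS k).dotProduct_mulVec_pos (x := x.ofLp) (by simpa using hx)
  simpa using h

lemma p_eq_of_ne_zero (hw : S.WeightsValid) (hS : ∀ k, (S.Sig k).PosDef)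
    {x : EuclideanSpace ℝ (Fin n)} (hx : x ≠ 0) :
    S.p x = ∑ k, S.w k * Phi (S.margin k x) := by
  rw [p_eq_sum x hw]
  refine Finset.sum_congr rfl fun k _ => ?_
  congr 1
  have hq := quad_pos hS k hx
  rw [margin, ← gaussianReal_real_Iic _ (Real.sqrt_pos.2 hq), Real.sq_sqrt hq.le,
    ← map_inner_multivariateGaussian _ (hS k).posSemidef,
    map_measureReal_apply (by fun_prop) measurableSet_Iic]
  rfl

lemma continuous_quad (k : Fin K) :
    Continuous fun x : EuclideanSpace ℝ (Fin n) => x.ofLp ⬝ᵥ (S.Sig k *ᵥ x.ofLp) := by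
  fun_prop

lemma continuousAt_margin (hS : ∀ k, (S.Sig k).PosDef) (k : Fin K)
    {x : EuclideanSpace ℝ (Fin n)} (hx : x ≠ 0) : ContinuousAt (S.margin k) x := by
  refine ContinuousAt.div (by fun_prop) ?_ (Real.sqrt_pos.2 (quad_pos hS k hx)).ne'
  exact ((continuous_quad k).sqrt).continuousAt

lemma continuousAt_p (hw : S.WeightsValid) (hS : ∀ k, (S.Sig k).PosDef)
    {x : EuclideanSpace ℝ (Fin n)} (hx : x ≠ 0) : ContinuousAt S.p x := by
  have h : S.p =ᶠ[𝓝 x] fun x => ∑ k, S.w k * Phi (S.margin k x) := by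
    filter_upwards [isOpen_ne.mem_nhds hx] with y hy using p_eq_of_ne_zero hw hS hy
  refine ContinuousAt.congr ?_ h.symm
  exact tendsto_finsetSum _ fun k _ =>
    (continuous_Phi.continuousAt.comp (continuousAt_margin hS k hx)).const_mul _

lemma tendsto_margin_zero (hS : ∀ k, (S.Sig k).PosDef) (hb : S.b < 0) (k : Fin K) :
    Tendsto (S.margin k) (𝓝[≠] 0) atBot := by
  have h1 : Tendsto (fun x : EuclideanSpace ℝ (Fin n) => S.b - inner ℝ x (S.mu k)) (𝓝[≠] 0)
      (𝓝 S.b) := by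
    have : Continuous fun x : EuclideanSpace ℝ (Fin n) => S.b - inner ℝ x (S.mu k) := by fun_prop
    simpa using (this.tendsto 0).mono_left nhdsWithin_le_nhds
  have h2 : Tendsto (fun x : EuclideanSpace ℝ (Fin n) => √(x.ofLp ⬝ᵥ (S.Sig k *ᵥ x.ofLp)))
      (𝓝[≠] 0) (𝓝[>] 0) := by
    refine tendsto_nhdsWithin_iff.2 ⟨?_, ?_⟩
    · simpa using ((continuous_quad k).sqrt.tendsto 0).mono_left nhdsWithin_le_nhds
    · filter_upwards [self_mem_nhdsWithin] with x hx using Real.sqrt_pos.2 (quad_pos hS k hx)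
  exact h1.neg_mul_atTop hb (tendsto_inv_nhdsGT_zero.comp h2)

/-- Away from 0 the function is continuous. At 0 it takes its maximal value 1 if b ≥ 0, where it may
jump; if b < 0, all margins tend to -∞ and p is continuous. Upper semicontinuity is enough for
closed superlevel sets and attained maxima. -/
lemma upperSemicontinuousAt_p (hw : S.WeightsValid) (hS : ∀ k, (S.Sig k).PosDef)
    (x : EuclideanSpace ℝ (Fin n)) : UpperSemicontinuousAt S.p x := by
  by_cases hx : x = 0
  · subst hx
    rcases le_or_gt 0 S.b with hb | hb
    · intro y hy
      rw [p_zero_of_nonneg hw hb] at hy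
      exact Eventually.of_forall fun x => (p_le_one hw x).trans_lt hy
    · refine ContinuousAt.upperSemicontinuousAt (continuousAt_iff_punctured_nhds.2 ?_)
      rw [p_zero_of_neg hw hb]
      have h : S.p =ᶠ[𝓝[≠] 0] fun x => ∑ k, S.w k * Phi (S.margin k x) := by
        filter_upwards [self_mem_nhdsWithin] with y hy using p_eq_of_ne_zero hw hS hy
      refine Tendsto.congr' h.symm ?_
      have : Tendsto (fun x => ∑ k, S.w k * Phi (S.margin k x)) (𝓝[≠] 0)
          (𝓝 (∑ k, S.w k * 0)) := tendsto_finsetSum _ fun k _ =>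
        (Phi_tendsto_atBot.comp (tendsto_margin_zero hS hb k)).const_mul _
      simpa using this
  · exact (continuousAt_p hw hS hx).upperSemicontinuousAt

lemma isClosed_superlevel (hw : S.WeightsValid) (hS : ∀ k, (S.Sig k).PosDef) (θ : ℝ) :
    IsClosed {x | θ ≤ S.p x} :=
  UpperSemicontinuous.isClosed_preimage (upperSemicontinuousAt_p hw hS) θ

lemma isCompact_P (hw : S.WeightsValid) (hS : ∀ k, (S.Sig k).PosDef) (hX : IsCompact S.X)
    (θ : ℝ) : IsCompact (S.P θ) :=
  hX.inter_right (isClosed_superlevel hw hS θ)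

/-- The margins are bounded below on the feasible region. -/
lemma exists_le_margin (hw : S.WeightsValid) (hS : ∀ k, (S.Sig k).PosDef) (hX : IsCompact S.X)
    (hθ : 0 < θ) (hzero : S.b = 0 → (0 : EuclideanSpace ℝ (Fin n)) ∉ S.X) :
    ∃ M : ℝ, ∀ x ∈ S.P θ, x ≠ 0 → ∀ k, M ≤ S.margin k x := by
  suffices h : ∀ k, ∃ M : ℝ, ∀ x ∈ S.P θ, x ≠ 0 → M ≤ S.margin k x by
    choose M hM using h
    refine ⟨-∑ k, |M k|, fun x hx hx0 k => le_trans ?_ (hM k x hx hx0)⟩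
    have := Finset.single_le_sum (f := fun k => |M k|) (fun i _ => abs_nonneg _)
      (Finset.mem_univ k)
    linarith [neg_abs_le (M k)]
  intro k
  have hc := isCompact_P hw hS hX θ
  rcases le_or_gt S.b 0 with hb | hb
  · have hne : ∀ x ∈ S.P θ, x ≠ 0 := by
      rintro x hx rfl
      rcases hb.lt_or_eq with hb | hb
      · have := hx.2
        rw [p_zero_of_neg hw hb] at this
        linarith
      · exact hzero hb hx.1
    obtain ⟨M, hM⟩ := hc.bddBelow_image (f := S.margin k) fun x hx =>
      (continuousAt_margin hS k (hne x hx)).continuousWithinAt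
    exact ⟨M, fun x hx _ => hM (mem_image_of_mem _ hx)⟩
  · have hopen : IsOpen {x : EuclideanSpace ℝ (Fin n) | 0 < S.b - inner ℝ x (S.mu k)} :=
      isOpen_lt continuous_const (by fun_prop)
    obtain ⟨M, hM⟩ := (hc.diff hopen).bddBelow_image (f := S.margin k) fun x hx =>
      (continuousAt_margin hS k (by rintro rfl; exact hx.2 (by simpa using hb))).continuousWithinAt
    refine ⟨min M 0, fun x hx _ => ?_⟩
    by_cases h : 0 < S.b - inner ℝ x (S.mu k)
    · exact (min_le_right _ _).trans (div_nonneg h.le (Real.sqrt_nonneg _))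
    · exact (min_le_left _ _).trans (hM (mem_image_of_mem _ ⟨hx, h⟩))

end Problem

/-! ### Perturbation of the probability level -/

/-- The coordinate functional of an independent family extends to the whole space and is represented
by a vector. Applied to LICQ, it gives a direction that raises p and keeps every binding linear
constraint. -/
lemma exists_inner_eq_of_linearIndependent {E ι : Type*} [NormedAddCommGroup E]
    [InnerProductSpace ℝ E] [FiniteDimensional ℝ E] {v : ι → E} (hv : LinearIndependent ℝ v)
    (i₀ : ι) : ∃ d : E, inner ℝ (v i₀) d = 1 ∧ ∀ i ≠ i₀, inner ℝ (v i) d = 0 := by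
  classical
  obtain ⟨g, hg⟩ := LinearMap.exists_leftInverse_of_injective (Finsupp.linearCombination ℝ v)
    (LinearMap.ker_eq_bot.2 hv)
  let f : E →ₗ[ℝ] ℝ := Finsupp.lapply i₀ ∘ₗ g
  have hf (i : ι) : f (v i) = (Finsupp.single i (1 : ℝ)) i₀ := by
    have h := LinearMap.congr_fun hg (Finsupp.single i 1)
    simp only [LinearMap.comp_apply, Finsupp.linearCombination_single, one_smul,
      LinearMap.id_apply] at h
    simp [f, h]
  refine ⟨(InnerProductSpace.toDual ℝ E).symm f.toContinuousLinearMap, ?_, fun i hi => ?_⟩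
  · rw [real_inner_comm, InnerProductSpace.toDual_symm_apply]
    simp [hf]
  · rw [real_inner_comm, InnerProductSpace.toDual_symm_apply]
    simp [hf, hi]

lemma HasDerivAt.eventually_lt_of_pos {g : ℝ → ℝ} {g' a : ℝ} (h : HasDerivAt g g' a)
    (hg' : 0 < g') : ∀ᶠ t in 𝓝[>] a, g a < g t := by
  have h1 := (hasDerivAt_iff_tendsto_slope.1 h).mono_left (nhdsGT_le_nhdsNE a)
  filter_upwards [h1.eventually (lt_mem_nhds hg'), self_mem_nhdsWithin] with t ht hat
  rw [slope_def_field] at ht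
  have := (div_pos_iff_of_pos_right (sub_pos.2 hat)).1 ht
  linarith

namespace Problem

variable {n K mE mI : ℕ} {S : Problem n K mE mI} {θ : ℝ}

lemma continuous_obj : Continuous S.obj := by
  unfold obj; fun_prop

lemma exists_isOptimal (hc : IsCompact (S.P θ)) (hne : (S.P θ).Nonempty) :
    ∃ x, S.IsOptimal θ x := by
  obtain ⟨x, hx, hmin⟩ := hc.exists_isMinOn hne continuous_obj.continuousOn
  exact ⟨x, hx, fun y hy => hmin hy⟩

/-- The optimal value does not jump down when the probability level is decreased. -/
lemma exists_obj_le_of_level_sub (hw : S.WeightsValid) (hS : ∀ k, (S.Sig k).PosDef)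
    (hX : IsCompact S.X) {xs : EuclideanSpace ℝ (Fin n)} (hxs : S.IsOptimal θ xs) {ε : ℝ}
    (hε : 0 < ε) : ∃ τ₁ > 0, ∀ τ ≤ τ₁, ∀ x ∈ S.P (θ - τ), S.obj xs - ε ≤ S.obj x := by
  -- On this compact set p stays below θ, and its maximum is attained, so p misses θ there by a
  -- uniform gap.
  set C := S.X ∩ {x | S.obj x ≤ S.obj xs - ε} with hC
  have hCc : IsCompact C := hX.inter_right (isClosed_le continuous_obj continuous_const)
  have hlt : ∀ x ∈ C, S.p x < θ := fun x hx => by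
    by_contra! h
    have h1 := hxs.2 x ⟨hx.1, h⟩
    have h2 : S.obj x ≤ S.obj xs - ε := hx.2
    linarith
  rcases C.eq_empty_or_nonempty with hemp | hne
  · refine ⟨1, one_pos, fun τ _ x hx => ?_⟩
    by_contra! h
    exact hemp.subset (show x ∈ C from ⟨hx.1, h.le⟩)
  · obtain ⟨x₀, hx₀, hmax⟩ := UpperSemicontinuousOn.exists_isMaxOn hne hCc
      fun x _ => (upperSemicontinuousAt_p hw hS x).upperSemicontinuousWithinAt C
    refine ⟨(θ - S.p x₀) / 2, half_pos (sub_pos.2 (hlt x₀ hx₀)), fun τ hτ x hx => ?_⟩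
    by_contra! h
    have h1 : S.p x ≤ S.p x₀ := hmax (show x ∈ C from ⟨hx.1, h.le⟩)
    have h2 := hx.2
    have h3 := hlt x₀ hx₀
    linarith

/-- Under LICQ the optimal value does not jump up when the probability level is increased. -/
lemma exists_obj_le_of_level_add {xs : EuclideanSpace ℝ (Fin n)} (hxs : xs ∈ S.P θ)
    (hL : S.LICQ θ xs) {ε : ℝ} (hε : 0 < ε) :
    ∃ τ₁ > 0, ∀ τ ≤ τ₁, ∃ x ∈ S.P (θ + τ), S.obj x ≤ S.obj xs + ε := by
  rcases hxs.2.lt_or_eq with hlt | heq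
  · exact ⟨S.p xs - θ, sub_pos.2 hlt, fun τ hτ => ⟨xs, ⟨hxs.1, by linarith⟩, by linarith⟩⟩
  · obtain ⟨d, hd1, hd0⟩ :=
      exists_inner_eq_of_linearIndependent hL (Sum.inr (Sum.inr ⟨(), heq.symm⟩))
    simp only [Sum.elim_inr] at hd1
    -- Without differentiability the gradient is 0 by default, which contradicts its inner product 1
    -- with d.
    have hdiff : DifferentiableAt ℝ S.p xs := by
      by_contra hcon
      rw [gradient_eq_zero_of_not_differentiableAt hcon, inner_zero_left] at hd1
      exact zero_ne_one hd1
    have hline : HasDerivAt (fun t : ℝ => xs + t • d) d 0 := by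
      simpa using ((hasDerivAt_id (0 : ℝ)).smul_const d).const_add xs
    have hder : HasDerivAt (fun t : ℝ => S.p (xs + t • d)) 1 0 := by
      have h1 : HasFDerivAt S.p (InnerProductSpace.toDual ℝ _ (gradient S.p xs))
          (xs + (0 : ℝ) • d) := by
        simpa using hdiff.hasGradientAt.hasFDerivAt
      have h2 := h1.comp_hasDerivAt (0 : ℝ) hline
      rw [InnerProductSpace.toDual_apply_apply, hd1] at h2
      exact h2
    have hcont : Continuous fun t : ℝ => xs + t • d := by fun_prop
    have hH (i : Fin mE) : (S.H *ᵥ d.ofLp) i = 0 := by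
      have := hd0 (Sum.inl i) (by simp)
      rw [Sum.elim_inl, real_inner_comm] at this
      simpa [PiLp.inner_apply, Matrix.mulVec, dotProduct, mul_comm] using this
    have hA (i : Fin mI) (hi : (S.A *ᵥ xs.ofLp) i = S.d i) : (S.A *ᵥ d.ofLp) i = 0 := by
      have := hd0 (Sum.inr (Sum.inl ⟨i, hi⟩)) (by simp)
      rw [Sum.elim_inr, Sum.elim_inl, real_inner_comm] at this
      simpa [PiLp.inner_apply, Matrix.mulVec, dotProduct, mul_comm] using this
    have hineq : ∀ᶠ t : ℝ in 𝓝[>] 0, ∀ i, S.d i ≤ (S.A *ᵥ (xs + t • d).ofLp) i := by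
      refine eventually_all.2 fun i => ?_
      rcases (hxs.1.2 i).lt_or_eq with hi | hi
      · have hc : Continuous fun t : ℝ => (S.A *ᵥ (xs + t • d).ofLp) i := by fun_prop
        have := (hc.tendsto 0).eventually (lt_mem_nhds (a := S.d i) (by simpa using hi))
        exact (this.filter_mono nhdsWithin_le_nhds).mono fun t ht => ht.le
      · refine Eventually.of_forall fun t => ?_
        simp [Matrix.mulVec_add, Matrix.mulVec_smul, hA i hi.symm, hi]
    have hobj : ∀ᶠ t : ℝ in 𝓝[>] 0, S.obj (xs + t • d) < S.obj xs + ε := by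
      have := (continuous_obj (S := S)).comp hcont
      exact ((this.tendsto 0).eventually_lt_const (u := S.obj xs + ε)
        (by simpa using hε)).filter_mono nhdsWithin_le_nhds
    obtain ⟨t, ht1, ht2, ht3⟩ :=
      ((HasDerivAt.eventually_lt_of_pos hder one_pos).and (hineq.and hobj)).exists
    rw [zero_smul, add_zero, ← heq] at ht1
    -- A single point on the ray serves every τ up to the increase of p attained there.
    refine ⟨S.p (xs + t • d) - θ, sub_pos.2 ht1, fun τ hτ => ⟨xs + t • d, ⟨⟨fun i => ?_, ht2⟩,
      by linarith⟩, ht3.le⟩⟩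
    have := hxs.1.1 i
    simp [Matrix.mulVec_add, Matrix.mulVec_smul, hH i, this]

end Problem

/-! ### The planar projections of the mixed-binary sets -/

/-- The pairs `(z, ζ)` with `ζ ∈ [0, 1]` admitted by the outer mixed-binary set. -/
def outerPairs (B : Breakpoints) (lo up : ℝ) : Set (ℝ × ℝ) :=
  {u | (0 ≤ u.2 ∧ u.2 ≤ 1) ∧ ∃ α t y, MemOuterSet B lo up α t y u.1 u.2}

/-- The pairs `(z, ζ)` with `ζ ∈ [0, 1]` admitted by the inner mixed-binary set. -/
def innerPairs (B : Breakpoints) (lo up : ℝ) : Set (ℝ × ℝ) :=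
  {u | (0 ≤ u.2 ∧ u.2 ≤ 1) ∧ ∃ α v t y, MemInnerSet B lo up α v t y u.1 u.2}

lemma isClosed_isBinary {X : Type*} [TopologicalSpace X] {f : X → ℝ} (hf : Continuous f) :
    IsClosed {x | IsBinary (f x)} :=
  (isClosed_eq hf continuous_const).union (isClosed_eq hf continuous_const)

/-- A finite union of coordinate subspaces: an index j ≥ m forces α = 0, which j = 0 already covers.
-/
lemma isClosed_isSOS2 (m : ℕ) : IsClosed {α : Fin m → ℝ | IsSOS2 α} := by
  have e : {α : Fin m → ℝ | IsSOS2 α} =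
      ⋃ j : Fin (m + 1), ⋂ i : Fin m, {α | α i ≠ 0 → (i : ℕ) = j ∨ (i : ℕ) = j + 1} := by
    ext α
    simp only [IsSOS2, mem_ofPred_eq, mem_iUnion, mem_iInter]
    constructor
    · rintro ⟨j, hj⟩
      by_cases h : j < m
      · exact ⟨⟨j, by omega⟩, hj⟩
      · refine ⟨0, fun i hi => ?_⟩
        have := hj i hi
        have := i.2
        omega
    · rintro ⟨j, hj⟩
      exact ⟨j, hj⟩
  rw [e]
  refine isClosed_iUnion_of_finite fun j => isClosed_iInter fun i => ?_
  by_cases h : (i : ℕ) = j ∨ (i : ℕ) = j + 1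
  · simp [h]
  · simp only [h, imp_false, not_not]
    exact isClosed_eq (continuous_apply i) continuous_const

lemma abs_le_of_binary {s : ℝ} (h : IsBinary s) : 0 ≤ s ∧ s ≤ 1 := by
  rcases h with h | h <;> simp [h]

lemma isClosed_memOuterSet (B : Breakpoints) (lo up : ℝ) :
    IsClosed {w : (ℝ × ℝ) × (Fin (B.L + 1) → ℝ) × (Fin 3 → ℝ) × (Fin 3 → ℝ) |
      MemOuterSet B lo up w.2.1 w.2.2.1 w.2.2.2 w.1.1 w.1.2} := by
  simp only [MemOuterSet, ofPred_and, ofPred_forall]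
  refine .inter (isClosed_iInter fun i => ?_) (.inter (isClosed_iInter fun j => ?_)
    (.inter (isClosed_iInter fun i => ?_) (.inter ?_ (.inter ?_ (.inter ?_ (.inter ?_ (.inter ?_
    (.inter ?_ (.inter ?_ (.inter ?_ (.inter ?_ ?_)))))))))))
  · exact isClosed_le (by fun_prop) (by fun_prop)
  · exact isClosed_isBinary (by fun_prop)
  · exact isClosed_le (by fun_prop) (by fun_prop)
  · exact isClosed_le (by fun_prop) (by fun_prop)
  · exact isClosed_eq (by fun_prop) (by fun_prop)
  · exact isClosed_eq (by fun_prop) (by fun_prop)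
  · exact isClosed_le (by fun_prop) (by fun_prop)
  · exact isClosed_le (by fun_prop) (by fun_prop)
  · exact isClosed_le (by fun_prop) (by fun_prop)
  · exact isClosed_le (by fun_prop) (by fun_prop)
  · exact isClosed_eq (by fun_prop) (by fun_prop)
  · exact isClosed_eq (by fun_prop) (by fun_prop)
  · exact (isClosed_isSOS2 (B.L + 1)).preimage (f := fun w : (ℝ × ℝ) × (Fin (B.L + 1) → ℝ) ×
      (Fin 3 → ℝ) × (Fin 3 → ℝ) => w.2.1) (by fun_prop)

lemma isClosed_memInnerSet (B : Breakpoints) (lo up : ℝ) :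
    IsClosed {w : (ℝ × ℝ) × (Fin B.L → ℝ) × (Fin B.L → ℝ) × (Fin 4 → ℝ) × (Fin 4 → ℝ) |
      MemInnerSet B lo up w.2.1 w.2.2.1 w.2.2.2.1 w.2.2.2.2 w.1.1 w.1.2} := by
  simp only [MemInnerSet, ofPred_and, ofPred_forall]
  refine .inter (isClosed_iInter fun i => ?_) (.inter (isClosed_iInter fun j => ?_)
    (.inter (isClosed_iInter fun i => ?_) (.inter ?_ (.inter ?_ (.inter ?_ (.inter ?_ (.inter ?_
    (.inter ?_ (.inter ?_ (.inter (isClosed_iInter fun i => .inter ?_ ?_) (.inter ?_ (.inter ?_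
    (.inter ?_ (.inter ?_ ?_))))))))))))))
  · exact isClosed_isBinary (by fun_prop)
  · exact isClosed_isBinary (by fun_prop)
  · exact isClosed_le (by fun_prop) (by fun_prop)
  · exact isClosed_le (by fun_prop) (by fun_prop)
  · exact isClosed_le (by fun_prop) (by fun_prop)
  · exact isClosed_eq (by fun_prop) (by fun_prop)
  · exact isClosed_eq (by fun_prop) (by fun_prop)
  · exact isClosed_le (by fun_prop) (by fun_prop)
  · exact isClosed_le (by fun_prop) (by fun_prop)
  · exact isClosed_eq (by fun_prop) (by fun_prop)
  · exact isClosed_le (by fun_prop) (by fun_prop)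
  · exact isClosed_le (by fun_prop) (by fun_prop)
  · exact isClosed_eq (by fun_prop) (by fun_prop)
  · exact isClosed_le (by fun_prop) (by fun_prop)
  · exact isClosed_le (by fun_prop) (by fun_prop)
  · exact isClosed_le (by fun_prop) (by fun_prop)
  · exact isClosed_le (by fun_prop) (by fun_prop)

lemma abs_mul_le_of_mem_unitInterval {s c : ℝ} (h : 0 ≤ s ∧ s ≤ 1) : |s * c| ≤ |c| := by
  rw [abs_mul, abs_of_nonneg h.1]
  exact mul_le_of_le_one_left (abs_nonneg c) h.2

lemma MemOuterSet.bounded (B : Breakpoints) (lo up : ℝ) : ∃ R : ℝ, ∀ α t y z ζ,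
    MemOuterSet B lo up α t y z ζ →
      |z| ≤ R ∧ (∀ i, |α i| ≤ R) ∧ (∀ j, |t j| ≤ R) ∧ ∀ j, |y j| ≤ R := by
  refine ⟨1 + |lo| + |B.leftEnd| + |up| + ∑ i : Fin (B.L + 1), |B.pt (-((i : ℕ) : ℤ))|, ?_⟩
  rintro α t y z ζ ⟨hα, ht, -, -, -, hz, hy0, hy0', hy2, hy2', hy1, ht1, -⟩
  have ht' := fun j => abs_le_of_binary (ht j)
  have hα1 (i) : 0 ≤ α i ∧ α i ≤ 1 :=
    ⟨hα i, (Finset.single_le_sum (fun i _ => hα i) (Finset.mem_univ i)).trans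
      (ht1.symm.trans_le (ht' 1).2)⟩
  have hs : |y 1| ≤ ∑ i : Fin (B.L + 1), |B.pt (-((i : ℕ) : ℤ))| := by
    rw [hy1]
    exact (Finset.abs_sum_le_sum_abs _ _).trans
      (Finset.sum_le_sum fun i _ => abs_mul_le_of_mem_unitInterval (hα1 i))
  have b1 := abs_le.1 (abs_mul_le_of_mem_unitInterval (c := lo) (ht' 0))
  have b2 := abs_le.1 (abs_mul_le_of_mem_unitInterval (c := B.leftEnd) (ht' 0))
  have b3 := abs_le.1 (abs_mul_le_of_mem_unitInterval (c := up) (ht' 2))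
  have n1 := abs_nonneg lo
  have n2 := abs_nonneg B.leftEnd
  have n3 := abs_nonneg up
  have n4 := abs_nonneg (y 1)
  have hs' := abs_le.1 hs
  refine ⟨?_, fun i => ?_, fun j => ?_, fun j => ?_⟩
  · rw [abs_le]; constructor <;> linarith
  · rw [abs_le]; constructor <;> linarith [hα1 i]
  · rw [abs_le]; constructor <;> linarith [ht' j]
  · fin_cases j <;> (rw [abs_le]; constructor <;> simp <;> linarith)

lemma MemInnerSet.bounded (B : Breakpoints) (lo up : ℝ) : ∃ R : ℝ, ∀ α v t y z ζ,
    MemInnerSet B lo up α v t y z ζ →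
      |z| ≤ R ∧ (∀ i, |α i| ≤ R) ∧ (∀ i, |v i| ≤ R) ∧ (∀ j, |t j| ≤ R) ∧ ∀ j, |y j| ≤ R := by
  refine ⟨1 + |lo| + |B.leftEnd| + 2 * |B.rightEnd| + |up| +
    ∑ i : Fin B.L, |B.pt (-((i : ℕ) : ℤ) - 1)|, ?_⟩
  rintro α v t y z ζ ⟨hα, ht, -, -, -, -, hz, hy0, hy0', ht1, hv, hy1, hy2, hy2', hy3, hy3'⟩
  have ht' := fun j => abs_le_of_binary (ht j)
  have hα' := fun j => abs_le_of_binary (hα j)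
  have hv1 (i) : |v i| ≤ |B.pt (-((i : ℕ) : ℤ) - 1)| := by
    have h1 := abs_le.1 (abs_mul_le_of_mem_unitInterval (c := B.pt (-((i : ℕ) : ℤ) - 1)) (hα' i))
    rw [abs_of_nonpos (hv i).2]
    linarith [(hv i).1, mul_comm (α i) (B.pt (-((i : ℕ) : ℤ) - 1))]
  have hs : ∑ i, |v i| ≤ ∑ i : Fin B.L, |B.pt (-((i : ℕ) : ℤ) - 1)| :=
    Finset.sum_le_sum fun i _ => hv1 i
  have hvi (i) : |v i| ≤ ∑ i, |v i| :=
    Finset.single_le_sum (f := fun i => |v i|) (fun i _ => abs_nonneg _) (Finset.mem_univ i)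
  have hys : |y 1| ≤ ∑ i, |v i| := by
    rw [hy1]; exact Finset.abs_sum_le_sum_abs _ _
  have b1 := abs_le.1 (abs_mul_le_of_mem_unitInterval (c := lo) (ht' 0))
  have b2 := abs_le.1 (abs_mul_le_of_mem_unitInterval (c := B.leftEnd) (ht' 0))
  have b3 := abs_le.1 (abs_mul_le_of_mem_unitInterval (c := B.rightEnd) (ht' 2))
  have b4 := abs_le.1 (abs_mul_le_of_mem_unitInterval (c := B.rightEnd) (ht' 3))
  have b5 := abs_le.1 (abs_mul_le_of_mem_unitInterval (c := up) (ht' 3))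
  rw [mul_comm] at b1 b2 b3 b4 b5
  have n1 := abs_nonneg lo
  have n2 := abs_nonneg B.leftEnd
  have n3 := abs_nonneg up
  have n4 := abs_nonneg (y 1)
  have n5 := abs_nonneg B.rightEnd
  have hs' := abs_le.1 hys
  refine ⟨?_, fun i => ?_, fun i => ?_, fun j => ?_, fun j => ?_⟩
  · rw [abs_le]; constructor <;> linarith
  · rw [abs_le]; constructor <;> linarith [hα' i]
  · linarith [hvi i]
  · rw [abs_le]; constructor <;> linarith [ht' j]
  · fin_cases j <;> (rw [abs_le]; constructor <;> simp <;> linarith)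

lemma mem_closedBall_zero_pi {m : ℕ} {f : Fin m → ℝ} {R : ℝ} (hR : 0 ≤ R) (h : ∀ i, |f i| ≤ R) :
    f ∈ Metric.closedBall (0 : Fin m → ℝ) R := by
  rw [mem_closedBall_zero_iff, pi_norm_le_iff_of_nonneg hR]
  exact h

/-- The projection of a closed set from a bounded box. The system bounds ζ only from above, hence
the explicit range [0, 1] in `outerPairs`. -/
lemma isCompact_outerPairs (B : Breakpoints) (lo up : ℝ) : IsCompact (outerPairs B lo up) := by
  obtain ⟨R, hR⟩ := MemOuterSet.bounded B lo up
  have hbox : IsCompact ((Icc (-R) R ×ˢ Icc (0 : ℝ) 1) ×ˢ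
      (Metric.closedBall (0 : Fin (B.L + 1) → ℝ) R ×ˢ
        (Metric.closedBall (0 : Fin 3 → ℝ) R ×ˢ Metric.closedBall (0 : Fin 3 → ℝ) R))) :=
    (isCompact_Icc.prod isCompact_Icc).prod ((isCompact_closedBall _ _).prod
      ((isCompact_closedBall _ _).prod (isCompact_closedBall _ _)))
  have h := (hbox.inter_right (isClosed_memOuterSet B lo up)).image continuous_fst
  convert h using 1
  ext ⟨z, ζ⟩
  simp only [outerPairs, mem_ofPred_eq, mem_image, Prod.exists]
  constructor
  · rintro ⟨hζ, α, t, y, hmem⟩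
    obtain ⟨h1, h2, h3, h4⟩ := hR _ _ _ _ _ hmem
    have hR0 : 0 ≤ R := (abs_nonneg _).trans h1
    exact ⟨z, ζ, α, t, y, ⟨⟨⟨abs_le.1 h1, hζ⟩, mem_closedBall_zero_pi hR0 h2,
      mem_closedBall_zero_pi hR0 h3, mem_closedBall_zero_pi hR0 h4⟩, hmem⟩, rfl⟩
  · rintro ⟨z', ζ', α, t, y, ⟨hbox, hmem⟩, he⟩
    obtain ⟨rfl, rfl⟩ := Prod.mk.inj he
    exact ⟨hbox.1.2, α, t, y, hmem⟩

lemma isCompact_innerPairs (B : Breakpoints) (lo up : ℝ) : IsCompact (innerPairs B lo up) := by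
  obtain ⟨R, hR⟩ := MemInnerSet.bounded B lo up
  have hbox : IsCompact ((Icc (-R) R ×ˢ Icc (0 : ℝ) 1) ×ˢ
      (Metric.closedBall (0 : Fin B.L → ℝ) R ×ˢ (Metric.closedBall (0 : Fin B.L → ℝ) R ×ˢ
        (Metric.closedBall (0 : Fin 4 → ℝ) R ×ˢ Metric.closedBall (0 : Fin 4 → ℝ) R)))) :=
    (isCompact_Icc.prod isCompact_Icc).prod ((isCompact_closedBall _ _).prod
      ((isCompact_closedBall _ _).prod ((isCompact_closedBall _ _).prod
        (isCompact_closedBall _ _))))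
  have h := (hbox.inter_right (isClosed_memInnerSet B lo up)).image continuous_fst
  convert h using 1
  ext ⟨z, ζ⟩
  simp only [innerPairs, mem_ofPred_eq, mem_image, Prod.exists]
  constructor
  · rintro ⟨hζ, α, v, t, y, hmem⟩
    obtain ⟨h1, h2, h3, h4, h5⟩ := hR _ _ _ _ _ _ hmem
    have hR0 : 0 ≤ R := (abs_nonneg _).trans h1
    exact ⟨z, ζ, α, v, t, y, ⟨⟨⟨abs_le.1 h1, hζ⟩, mem_closedBall_zero_pi hR0 h2,
      mem_closedBall_zero_pi hR0 h3, mem_closedBall_zero_pi hR0 h4,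
      mem_closedBall_zero_pi hR0 h5⟩, hmem⟩, rfl⟩
  · rintro ⟨z', ζ', α, v, t, y, ⟨hbox, hmem⟩, he⟩
    obtain ⟨rfl, rfl⟩ := Prod.mk.inj he
    exact ⟨hbox.1.2, α, v, t, y, hmem⟩

/-! ### The models between two superlevel sets of p -/

namespace Problem

variable {n K mE mI : ℕ} {S : Problem n K mE mI} {θ : ℝ}

/-- Decisions feasible for a model whose pairs `(z k, ζ k)` range over `Q`. -/
def modelFeasible (S : Problem n K mE mI) (θ : ℝ) (Q : Set (ℝ × ℝ)) :
    Set (EuclideanSpace ℝ (Fin n)) :=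
  {x | ∃ z ζ lam, S.CommonConstraints θ x z ζ lam ∧ ∀ k, (z k, ζ k) ∈ Q}

/-- `x` minimizes the objective over `modelFeasible`. -/
def IsModelOptimal (S : Problem n K mE mI) (θ : ℝ) (Q : Set (ℝ × ℝ))
    (x : EuclideanSpace ℝ (Fin n)) : Prop :=
  x ∈ S.modelFeasible θ Q ∧ ∀ y ∈ S.modelFeasible θ Q, S.obj x ≤ S.obj y

lemma mem_modelFeasible_outerPairs {B : Breakpoints} {lo up : ℝ} {x : EuclideanSpace ℝ (Fin n)} :
    x ∈ S.modelFeasible θ (outerPairs B lo up) ↔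
      ∃ z ζ lam α t y, S.OuterFeasible θ B lo up x z ζ lam α t y := by
  constructor
  · rintro ⟨z, ζ, lam, hc, hQ⟩
    choose α t y h using fun k => (hQ k).2
    exact ⟨z, ζ, lam, α, t, y, hc, h⟩
  · rintro ⟨z, ζ, lam, α, t, y, hc, h⟩
    exact ⟨z, ζ, lam, hc, fun k => ⟨hc.2.2.1 k, α k, t k, y k, h k⟩⟩

lemma mem_modelFeasible_innerPairs {B : Breakpoints} {lo up : ℝ} {x : EuclideanSpace ℝ (Fin n)} :
    x ∈ S.modelFeasible θ (innerPairs B lo up) ↔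
      ∃ z ζ lam α v t y, S.InnerFeasible θ B lo up x z ζ lam α v t y := by
  constructor
  · rintro ⟨z, ζ, lam, hc, hQ⟩
    choose α v t y h using fun k => (hQ k).2
    exact ⟨z, ζ, lam, α, v, t, y, hc, h⟩
  · rintro ⟨z, ζ, lam, α, v, t, y, hc, h⟩
    exact ⟨z, ζ, lam, hc, fun k => ⟨hc.2.2.1 k, α k, v k, t k, y k, h k⟩⟩

lemma isOuterOptimal_iff {B : Breakpoints} {lo up : ℝ} {x : EuclideanSpace ℝ (Fin n)} :
    S.IsOuterOptimal θ B lo up x ↔ S.IsModelOptimal θ (outerPairs B lo up) x := by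
  rw [IsOuterOptimal, IsModelOptimal, ← mem_modelFeasible_outerPairs]
  refine and_congr_right fun _ => ⟨fun h y hy => ?_, fun h y z ζ lam α t y' hy => ?_⟩
  · obtain ⟨z, ζ, lam, α, t, y', hy⟩ := mem_modelFeasible_outerPairs.1 hy
    exact h _ _ _ _ _ _ _ hy
  · exact h _ (mem_modelFeasible_outerPairs.2 ⟨_, _, _, _, _, _, hy⟩)

lemma isInnerOptimal_iff {B : Breakpoints} {lo up : ℝ} {x : EuclideanSpace ℝ (Fin n)} :
    S.IsInnerOptimal θ B lo up x ↔ S.IsModelOptimal θ (innerPairs B lo up) x := by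
  rw [IsInnerOptimal, IsModelOptimal, ← mem_modelFeasible_innerPairs]
  refine and_congr_right fun _ => ⟨fun h y hy => ?_, fun h y z ζ lam α v t y' hy => ?_⟩
  · obtain ⟨z, ζ, lam, α, v, t, y', hy⟩ := mem_modelFeasible_innerPairs.1 hy
    exact h _ _ _ _ _ _ _ _ hy
  · exact h _ (mem_modelFeasible_innerPairs.2 ⟨_, _, _, _, _, _, _, hy⟩)

lemma isClosed_X : IsClosed S.X := by
  simp only [X, ofPred_and, ofPred_forall]
  exact .inter (isClosed_iInter fun i => isClosed_eq (by fun_prop) (by fun_prop))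
    (isClosed_iInter fun i => isClosed_le (by fun_prop) (by fun_prop))

lemma isCompact_modelFeasible (hX : IsCompact S.X) {Q : Set (ℝ × ℝ)} (hQ : IsCompact Q) :
    IsCompact (S.modelFeasible θ Q) := by
  have hlam (k : Fin K) : ∃ R : ℝ, ∀ x ∈ S.X, x.ofLp ⬝ᵥ (S.Sig k *ᵥ x.ofLp) ≤ R := by
    obtain ⟨R, hR⟩ := hX.bddAbove_image (continuous_quad (S := S) k).continuousOn
    exact ⟨R, fun x hx => hR (mem_image_of_mem _ hx)⟩
  choose R hR using hlam
  -- λₖ ≤ λₖ² + 1, and λₖ² = xᵀΣₖx is bounded on X.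
  have hbox : IsCompact (S.X ×ˢ ((univ.pi fun k => Icc 0 (R k + 1)) ×ˢ
      (univ.pi fun _ : Fin K => Q))) :=
    hX.prod ((isCompact_univ_pi fun k => isCompact_Icc).prod (isCompact_univ_pi fun _ => hQ))
  have hcl : IsClosed {w : EuclideanSpace ℝ (Fin n) × (Fin K → ℝ) × (Fin K → ℝ × ℝ) |
      S.CommonConstraints θ w.1 (fun k => (w.2.2 k).1) (fun k => (w.2.2 k).2) w.2.1} := by
    simp only [CommonConstraints, ofPred_and, ofPred_forall]
    refine .inter ?_ (.inter (isClosed_X.preimage continuous_fst)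
      (.inter (isClosed_iInter fun k => .inter ?_ ?_) (.inter (isClosed_iInter fun k => ?_)
        (isClosed_iInter fun k => .inter ?_ ?_))))
    · exact isClosed_le (by fun_prop) (by fun_prop)
    · exact isClosed_le (by fun_prop) (by fun_prop)
    · exact isClosed_le (by fun_prop) (by fun_prop)
    · exact isClosed_le (by fun_prop) (by fun_prop)
    · exact isClosed_le (by fun_prop) (by fun_prop)
    · exact isClosed_eq (by fun_prop) (by fun_prop)
  have h := (hbox.inter_right hcl).image continuous_fst
  convert h using 1
  ext x
  simp only [modelFeasible, mem_ofPred_eq, mem_image]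
  constructor
  · rintro ⟨z, ζ, lam, hc, hmem⟩
    refine ⟨(x, lam, fun k => (z k, ζ k)),
      ⟨⟨hc.2.1, fun k _ => ⟨hc.2.2.2.1 k, ?_⟩, fun k _ => hmem k⟩, hc⟩, rfl⟩
    have h1 := (hc.2.2.2.2 k).2
    have h2 := hR k x hc.2.1
    nlinarith [sq_nonneg (lam k - 1)]
  · rintro ⟨⟨x, lam, u⟩, ⟨hbox, hc⟩, rfl⟩
    exact ⟨_, _, lam, hc, fun k => hbox.2.2 k (mem_univ k)⟩

lemma exists_isModelOptimal (hX : IsCompact S.X) {Q : Set (ℝ × ℝ)} (hQ : IsCompact Q)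
    (hne : (S.modelFeasible θ Q).Nonempty) : ∃ x, S.IsModelOptimal θ Q x := by
  obtain ⟨x, hx, hmin⟩ :=
    (isCompact_modelFeasible (θ := θ) hX hQ).exists_isMinOn hne continuous_obj.continuousOn
  exact ⟨x, hx, fun y hy => hmin hy⟩

/-- For x ≠ 0, λₖ is the positive square root of xᵀΣₖx, so zₖ is at most the margin and the bounds
on ζₖ average to p(x) + τ. For x = 0, λₖ = 0 and the constraint reads 0 ≤ b, whence p(0) = 1. -/
lemma modelFeasible_subset_P (hw : S.WeightsValid) (hS : ∀ k, (S.Sig k).PosDef)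
    {τ : ℝ} (hτ : 0 ≤ τ) (hθ : θ ≤ 1) {Q : Set (ℝ × ℝ)} (hQ : ∀ u ∈ Q, u.2 ≤ Phi u.1 + τ) :
    S.modelFeasible θ Q ⊆ S.P (θ - τ) := by
  rintro x ⟨z, ζ, lam, ⟨hsum, hxX, hζ, hlam, hc⟩, hmem⟩
  refine ⟨hxX, ?_⟩
  by_cases hx : x = 0
  · subst hx
    have hK : Nonempty (Fin K) := by
      by_contra hcon
      rw [not_nonempty_iff] at hcon
      simpa using hw.2
    obtain ⟨k⟩ := hK
    have h1 := hc k
    have hl : lam k = 0 := by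
      have := h1.2
      simpa using this.symm
    have hb : 0 ≤ S.b := by
      have := h1.1
      simpa [hl] using this
    rw [p_zero_of_nonneg hw hb]
    linarith
  · rw [p_eq_of_ne_zero hw hS hx]
    have hle (k) : S.w k * ζ k ≤ S.w k * (Phi (S.margin k x) + τ) := by
      refine mul_le_mul_of_nonneg_left ((hQ _ (hmem k)).trans ?_) (hw.1 k)
      have hlk : √(x.ofLp ⬝ᵥ (S.Sig k *ᵥ x.ofLp)) = lam k := by
        rw [(hc k).2, Real.sqrt_sq (hlam k)]
      have hpos : 0 < lam k := hlk ▸ Real.sqrt_pos.2 (quad_pos hS k hx)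
      have : z k ≤ S.margin k x := by
        rw [margin, hlk, le_div_iff₀ hpos]; exact (hc k).1
      linarith [Phi_strictMono.monotone this]
    have h1 := hsum.trans (Finset.sum_le_sum fun k _ => hle k)
    simp only [mul_add, Finset.sum_add_distrib, ← Finset.sum_mul, hw.2] at h1
    linarith

/-- The values ζₖ = `Phi` (margin) - τ average to p(x) - τ ≥ θ; they are nonnegative because τ ≤
`Phi M`. At the origin, ζₖ = 1 - τ with λₖ = 0 takes their place. -/
lemma P_subset_modelFeasible (hw : S.WeightsValid) (hS : ∀ k, (S.Sig k).PosDef)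
    {τ M : ℝ} (hτ : 0 ≤ τ) (hτM : τ ≤ Phi M) (hθτ : 0 < θ + τ)
    (hM : ∀ x ∈ S.P (θ + τ), x ≠ 0 → ∀ k, M ≤ S.margin k x) {Q : Set (ℝ × ℝ)}
    (hQ : ∀ q, M ≤ q → ∃ z ≤ q, (z, Phi q - τ) ∈ Q) (hQ1 : ∃ z, (z, 1 - τ) ∈ Q) :
    S.P (θ + τ) ⊆ S.modelFeasible θ Q := by
  intro x hx
  by_cases hx0 : x = 0
  · subst hx0
    obtain ⟨z, hz⟩ := hQ1
    have hb : 0 ≤ S.b := by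
      by_contra! hb
      have := hx.2
      rw [p_zero_of_neg hw hb] at this
      linarith
    have h1 := hx.2.trans (p_le_one hw 0)
    have h2 := Phi_le_one M
    refine ⟨fun _ => z, fun _ => 1 - τ, fun _ => 0, ⟨?_, hx.1, fun k => ⟨by linarith, by linarith⟩,
      by simp, fun k => by simp [hb]⟩, fun k => hz⟩
    rw [← Finset.sum_mul, hw.2]
    linarith
  · choose z hzq hz using fun k => hQ _ (hM x hx hx0 k)
    refine ⟨z, fun k => Phi (S.margin k x) - τ, fun k => √(x.ofLp ⬝ᵥ (S.Sig k *ᵥ x.ofLp)),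
      ⟨?_, hx.1, fun k => ⟨?_, ?_⟩, fun k => Real.sqrt_nonneg _, fun k => ⟨?_, ?_⟩⟩, hz⟩
    · have := hx.2
      rw [p_eq_of_ne_zero hw hS hx0] at this
      simp only [mul_sub, Finset.sum_sub_distrib, ← Finset.sum_mul, hw.2]
      linarith
    · have := Phi_strictMono.monotone (hM x hx hx0 k)
      linarith
    · linarith [Phi_le_one (S.margin k x)]
    · have hpos := Real.sqrt_pos.2 (quad_pos hS k hx0)
      rw [← le_div_iff₀ hpos]
      exact hzq k
    · rw [Real.sq_sqrt (quad_pos hS k hx0).le]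

end Problem

namespace Problem

variable {n K mE mI : ℕ} {S : Problem n K mE mI} {θ : ℝ}

lemma P_anti {θ₁ θ₂ : ℝ} (h : θ₁ ≤ θ₂) : S.P θ₂ ⊆ S.P θ₁ := fun _ hx => ⟨hx.1, h.trans hx.2⟩

/-- At b = 0 the origin has p = 1, so membership in X would put it in P(θ). -/
lemma zero_notMem_X (hw : S.WeightsValid) (hθ : θ ≤ 1)
    (h : S.b = 0 → ∃ δ : ℝ, 0 < δ ∧ S.P θ ∩ {x | ‖x‖ ≤ δ} = ∅) (hb : S.b = 0) :
    (0 : EuclideanSpace ℝ (Fin n)) ∉ S.X := by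
  intro h0
  obtain ⟨δ, hδ, hemp⟩ := h hb
  have hp : S.p 0 = 1 := p_zero_of_nonneg hw hb.ge
  exact hemp.subset (show (0 : EuclideanSpace ℝ (Fin n)) ∈ S.P θ ∩ {x | ‖x‖ ≤ δ} from
    ⟨⟨h0, by rwa [hp]⟩, by simpa using hδ.le⟩)

/-- Optimal values of a model sandwiched between two feasible regions are sandwiched. -/
lemma IsModelOptimal.obj_mem_Icc {Q : Set (ℝ × ℝ)} {x xp xm : EuclideanSpace ℝ (Fin n)}
    {θ₁ θ₂ : ℝ} (hx : S.IsModelOptimal θ Q x) (hxp : S.IsOptimal θ₂ xp) (hxm : S.IsOptimal θ₁ xm)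
    (h1 : S.P θ₂ ⊆ S.modelFeasible θ Q) (h2 : S.modelFeasible θ Q ⊆ S.P θ₁) :
    S.obj x ∈ Icc (S.obj xm) (S.obj xp) :=
  ⟨hxm.2 x (h2 hx.1), hx.2 xp (h1 hxp.1)⟩

lemma IsModelOptimal.isTolOptimal {Q : Set (ℝ × ℝ)} {x xp xm xs : EuclideanSpace ℝ (Fin n)}
    {τ ε : ℝ} (hτ : 0 ≤ τ) (hτε : τ ≤ ε) (hx : S.IsModelOptimal θ Q x)
    (hxs : S.IsOptimal θ xs) (hxp : S.IsOptimal (θ + τ) xp) (hxm : S.IsOptimal (θ - τ) xm)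
    (h1 : S.P (θ + τ) ⊆ S.modelFeasible θ Q) (h2 : S.modelFeasible θ Q ⊆ S.P (θ - τ))
    (hgap : |S.obj xp - S.obj xm| ≤ ε) : S.IsTolOptimal θ ε xs x := by
  have hx' := hx.obj_mem_Icc hxp hxm h1 h2
  have hs1 := hxm.2 xs (P_anti (by linarith) hxs.1)
  have hs2 := hxs.2 xp (P_anti (by linarith) hxp.1)
  have hP := h2 hx.1
  refine ⟨⟨hP.1, by linarith [hP.2]⟩, ?_⟩
  have := (abs_le.1 hgap).2
  rw [abs_le]
  constructor <;> linarith [hx'.1, hx'.2]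

end Problem

end GMMChance

/-! ### Choice of τ and conclusion -/

open GMMChance in
theorem theorem2 :
    ∃ C : ℝ, 0 < C ∧
      ∀ (n K mE mI : ℕ) (S : Problem n K mE mI) (θ : ℝ),
        0 < θ → θ < 1 → S.WeightsValid → IsCompact S.X →
        -- positive definite covariances
        (∀ k, (S.Sig k).PosDef) →
        -- feasibility near `θ`
        (∃ ρ : ℝ, 0 < ρ ∧ ∀ θ' ∈ Set.Icc (θ - ρ) (θ + ρ), (S.P θ').Nonempty) →
        -- the origin is excluded when `b = 0`
        (S.b = 0 → ∃ δ : ℝ, 0 < δ ∧ S.P θ ∩ {x | ‖x‖ ≤ δ} = ∅) →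
        -- LICQ at all optimal solutions
        (∀ x, S.IsOptimal θ x → S.LICQ θ x) →
        ∀ xs, S.IsOptimal θ xs →
        ∀ τhat : ℝ, 0 < τhat →
        ∃ τ : ℝ, 0 < τ ∧ τ ≤ τhat ∧
          -- `O(√((1/τ) log (1/τ)))` breakpoints suffice for accuracy `τ`
          (∃ B : Breakpoints, B.OuterAccurate τ ∧
            (B.count : ℝ) ≤ C * √(1 / τ * Real.log (1 / τ))) ∧
          (∃ B : Breakpoints, B.InnerAccurate τ ∧
            (B.count : ℝ) ≤ C * √(1 / τ * Real.log (1 / τ))) ∧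
          ∃ xp xm, S.IsOptimal (θ + τ) xp ∧ S.IsOptimal (θ - τ) xm ∧
            |S.obj xp - S.obj xm| ≤ τhat ∧
            -- the models built with arrays of accuracy `τ`
            ∀ BO : Breakpoints, BO.OuterAccurate τ →
            ∀ BI : Breakpoints, BI.InnerAccurate τ →
            ∀ loO upO : ℝ, loO ≤ BO.leftEnd → BO.rightEnd ≤ upO →
            ∀ loI upI : ℝ, loI ≤ BI.leftEnd → BI.rightEnd ≤ upI →
              (∃ xOA, S.IsOuterOptimal θ BO loO upO xOA) ∧
              (∃ xIA, S.IsInnerOptimal θ BI loI upI xIA) ∧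
              (∀ xOA, S.IsOuterOptimal θ BO loO upO xOA → S.IsTolOptimal θ τhat xs xOA) ∧
              (∀ xIA, S.IsInnerOptimal θ BI loI upI xIA → S.IsTolOptimal θ τhat xs xIA) ∧
              ∀ xOA xIA, S.IsOuterOptimal θ BO loO upO xOA →
                S.IsInnerOptimal θ BI loI upI xIA →
                |S.obj xIA - S.obj xOA| ≤ |S.obj xp - S.obj xm| := by
  refine ⟨6, by norm_num, ?_⟩
  intro n K mE mI S θ hθ0 hθ1 hw hX hS ⟨ρ, hρ, hne⟩ hb0 hL xs hxs τhat hτhat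
  obtain ⟨M, hM⟩ := Problem.exists_le_margin hw hS hX hθ0 (Problem.zero_notMem_X hw hθ1.le hb0)
  obtain ⟨τ₁, hτ₁, hτ₁M, htails⟩ := Breakpoints.exists_tails_threshold M
  obtain ⟨τ₂, hτ₂, hlow⟩ := Problem.exists_obj_le_of_level_sub hw hS hX hxs (half_pos hτhat)
  obtain ⟨τ₃, hτ₃, hupp⟩ := Problem.exists_obj_le_of_level_add hxs.1 (hL xs hxs) (half_pos hτhat)
  -- ρ keeps both perturbed problems feasible, τ₁ handles all arrays at once, τ₂ and τ₃ each bound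
  -- one side of the gap by τhat / 2, and 1/e is needed for the breakpoint count.
  obtain ⟨τ, hτ0, hτ⟩ : ∃ τ > 0, τ ≤ τhat ∧ τ ≤ ρ ∧ τ ≤ τ₁ ∧ τ ≤ τ₂ ∧ τ ≤ τ₃ ∧
      τ ≤ Real.exp (-1) := by
    refine ⟨min τhat (min ρ (min τ₁ (min τ₂ (min τ₃ (Real.exp (-1)))))), ?_, ?_⟩
    · simp only [gt_iff_lt, lt_min_iff]
      exact ⟨hτhat, hρ, hτ₁, hτ₂, hτ₃, Real.exp_pos _⟩
    · simp
  obtain ⟨hτhat', hτρ, hττ₁, hττ₂, hττ₃, hτe⟩ := hτ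
  obtain ⟨B, hBO, hBI, hBc⟩ := Breakpoints.exists_accurate hτ0 hτe
  obtain ⟨xp, hxp⟩ := Problem.exists_isOptimal (Problem.isCompact_P hw hS hX (θ + τ))
    (hne _ ⟨by linarith, by linarith⟩)
  obtain ⟨xm, hxm⟩ := Problem.exists_isOptimal (Problem.isCompact_P hw hS hX (θ - τ))
    (hne _ ⟨by linarith, by linarith⟩)
  have hgap : |S.obj xp - S.obj xm| ≤ τhat := by
    obtain ⟨x, hx, hxobj⟩ := hupp τ hττ₃
    have h1 := hxp.2 x hx
    have h2 := hlow τ hττ₂ xm hxm.1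
    have h3 := hxm.2 xp (Problem.P_anti (by linarith) hxp.1)
    rw [abs_le]
    constructor <;> linarith
  have hMτ : ∀ x ∈ S.P (θ + τ), x ≠ 0 → ∀ k, M ≤ S.margin k x := fun x hx =>
    hM x (Problem.P_anti (by linarith) hx)
  have hτM : τ < Phi M := hττ₁.trans_lt hτ₁M
  refine ⟨τ, hτ0, hτhat', ⟨B, hBO, hBc⟩, ⟨B, hBI, hBc⟩, xp, xm, hxp, hxm, hgap, ?_⟩
  intro BO hBO BI hBI loO upO _ hupO loI upI _ hupI
  have hζ {q : ℝ} (hq : M ≤ q) : 0 ≤ Phi q - τ ∧ Phi q - τ ≤ 1 :=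
    ⟨by linarith [Phi_strictMono.monotone hq], by linarith [Phi_le_one q]⟩
  have hζ1 : 0 ≤ 1 - τ ∧ 1 - τ ≤ 1 := ⟨by linarith [Phi_le_one M], by linarith⟩
  have hO1 : S.P (θ + τ) ⊆ S.modelFeasible θ (outerPairs BO loO upO) := by
    refine Problem.P_subset_modelFeasible hw hS hτ0.le hτM.le (by linarith) hMτ (fun q hq => ?_) ?_
    · obtain ⟨z, hz, h⟩ := exists_memOuterSet (lo := loO) hBO hupO
        ((htails τ hττ₁ BO hBO.1).1.trans hq)
      exact ⟨z, hz, hζ hq, h⟩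
    · obtain ⟨z, h⟩ := exists_memOuterSet_up (lo := loO) hBO hupO
      exact ⟨z, hζ1, h⟩
  have hO2 : S.modelFeasible θ (outerPairs BO loO upO) ⊆ S.P (θ - τ) :=
    Problem.modelFeasible_subset_P hw hS hτ0.le hθ1.le fun u ⟨_, _, _, _, hu⟩ => hu.le_Phi_add hBO
  have hI1 : S.P (θ + τ) ⊆ S.modelFeasible θ (innerPairs BI loI upI) := by
    refine Problem.P_subset_modelFeasible hw hS hτ0.le hτM.le (by linarith) hMτ (fun q hq => ?_) ?_
    · obtain ⟨z, hz, h⟩ := exists_memInnerSet (lo := loI) hBI hupI hτM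
        (htails τ hττ₁ BI hBI.1).2 hq
      exact ⟨z, hz, hζ hq, h⟩
    · exact ⟨upI, hζ1, exists_memInnerSet_of_rightEnd_le le_rfl hupI hBI.1.right⟩
  have hI2 : S.modelFeasible θ (innerPairs BI loI upI) ⊆ S.P (θ - τ) :=
    Problem.modelFeasible_subset_P hw hS hτ0.le hθ1.le fun u ⟨_, _, _, _, _, hu⟩ =>
      (hu.le_Phi hBI).trans (by linarith)
  simp only [Problem.isOuterOptimal_iff, Problem.isInnerOptimal_iff]
  refine ⟨Problem.exists_isModelOptimal hX (isCompact_outerPairs BO loO upO) ⟨xp, hO1 hxp.1⟩,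
    Problem.exists_isModelOptimal hX (isCompact_innerPairs BI loI upI) ⟨xp, hI1 hxp.1⟩,
    fun x hx => hx.isTolOptimal hτ0.le hτhat' hxs hxp hxm hO1 hO2 hgap,
    fun x hx => hx.isTolOptimal hτ0.le hτhat' hxs hxp hxm hI1 hI2 hgap, fun xO xI hxO hxI => ?_⟩
  have hO := hxO.obj_mem_Icc hxp hxm hO1 hO2
  have hI := hxI.obj_mem_Icc hxp hxm hI1 hI2
  refine (abs_le.2 ⟨?_, ?_⟩).trans (le_abs_self _) <;> linarith [hO.1, hO.2, hI.1, hI.2]
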